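/- Let $\Bbbk$ be an algebraically closed field of characteristic $0$ and $p\ge 1$. Let ${\rm Y}_p={\rm Y}_p(\mathfrak{gl}_2)$ be the Yangian of level $p$, i.e. the associative unital $\Bbbk$-algebra with generators $t_{ij}^{(r)}$ ($i,j\in\{1,2\}$, $1\le r\le p$) and relations $$[t^{(r)}_{ij}, t^{(s)}_{kl}] =\sum_{a=1}^{\min(r,s)}\big(t^{(a-1)}_{kj} t^{(r+s-a)}_{il}-t^{(r+s-a)}_{kj} t^{(a-1)}_{il}\big),$$ where $t^{(0)}_{ij}=\delta_{ij}$ and $t^{(r)}_{ij}=0$ for $r>p$. Put $T_{ij}(u)=\delta_{ij}u^p+\sum_{r=1}^p t_{ij}^{(r)}u^{p-r}$ and $D(u)=T_{11}(u)T_{22}(u-1)-T_{21}(u)T_{12}(u-1)$, and let $\Gamma\subseteq {\rm Y}_p$ be the commutative subalgebra generated by the coefficients of $T_{22}(u)$ and $D(u)$; ${\rm Sp}\,\Gamma$ is the set of its maximal ideals. For $\ell=(\beta,\gamma)\in\Bbbk^{p}\times\Bbbk^{2p}$ put $\beta(u)=\prod_{i=1}^p(u+\beta_i)$, $\gamma(u)=\prod_{i=1}^{2p}(u+\gamma_i)$,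 and let $\mathbf m_\ell\in{\rm Sp}\,\Gamma$ be the ideal generated by the coefficients of $T_{22}(u)-\beta(u)$ and $D(u)-\gamma(u)$. Call $\ell$ generic if $\beta_i-\beta_j\notin\mathbb Z$ for all $i\ne j$. A weight module is a finitely generated ${\rm Y}_p$-module $V$ with $V=\bigoplus_{\mathbf m\in{\rm Sp}\,\Gamma}V(\mathbf m)$, where $V(\mathbf m)=\{x : \mathbf m^r x=0\text{ for some }r\}$, such that $\mathbf m\,V(\mathbf m)=0$ for all $\mathbf m$. It has central character $\gamma$ if $D(u)$ acts on it as $\gamma(u)$; then for $\psi\in\Bbbk^p$ its weight space of weight $\psi$ is $V_\psi=\{x : T_{22}(u)x=\psi(u)x,\ D(u)x=\gamma(u)x\}$. Let $\Delta$ be the smallest equivalence relation on ${\rm Sp}\,\Gamma$ such that $\mathbf m\,\Delta\,\mathbf n$ whenever, for some $a\in{\rm Y}_p$, the $\Gamma$-module $\Gamma/\mathbf n$ is a subquotient of $\Gamma a\Gamma/\Gamma a\mathbf m$. A generic weight module is a weight module $V$ for which there is a generic $\ell'=(\beta',\gamma')$ such that $V$ has central character $\gamma'$ and every $\mathbf m$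 with $V(\mathbf m)\neq0$ is $\Delta$-equivalent to $\mathbf m_{\ell'}$. Let $M(\ell)={\rm Y}_p/I_\ell$, where $I_\ell$ is the left ideal generated by the coefficients of $T_{22}(u)-\beta(u)$ and $D(u)-\gamma(u)$, and let $L(\ell)$ be the quotient of $M(\ell)$ by the sum of all its proper submodules. **Corollary.** Let $\ell=(\beta,\gamma)$ be generic. (1) $L(\ell)$ is an irreducible generic weight ${\rm Y}_p$-module with central character $\gamma$ and with $L(\ell)_\beta\ne0$. Moreover, $\dim_\Bbbk L(\ell)_\psi=1$ for every $\psi\in\Bbbk^p$ with $L(\ell)_\psi\neq 0$. (2) Every irreducible weight ${\rm Y}_p$-module with central character $\gamma$ that is generated by a nonzero vector of weight $\beta$ is isomorphic to $L(\ell)$. -/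

import Mathlib

open Polynomial

noncomputable section

namespace LevelYangian

/-! ### Harish-Chandra modules for a pair `(U, Γ)` -/

section Pair

variable {k U : Type*} [Field k] [Ring U] [Algebra k U] (Γ : Subalgebra k U)

/-- The maximal spectrum `Sp Γ` of the (commutative) subalgebra `Γ`. -/
abbrev Sp : Type _ := {m : Ideal Γ // m.IsMaximal}

/-- The left `Γ`-submodule `Γ a Γ` of `U`. -/
def bimod (a : U) : Submodule Γ U :=
  Submodule.span Γ {x | ∃ z : Γ, x = a * (z : U)}

/-- The left `Γ`-submodule `Γ a m` of `U`. -/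
def bimodIdeal (a : U) (m : Ideal Γ) : Submodule Γ U :=
  Submodule.span Γ {x | ∃ z ∈ m, x = a * (z : U)}

/-- `(m, n) ∈ X_a`: the `Γ`-module `Γ / n` is a subquotient of `Γ a Γ / Γ a m`, that is, it is
isomorphic to `N / N'` for submodules `Γ a m ≤ N' ≤ N ≤ Γ a Γ`. -/
def Linked (a : U) (m n : Ideal Γ) : Prop :=
  ∃ N' N : Submodule Γ U, bimodIdeal Γ a m ≤ N' ∧ N' ≤ N ∧ N ≤ bimod Γ a ∧
    Nonempty ((N ⧸ N'.submoduleOf N) ≃ₗ[Γ] (Γ ⧸ n))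

/-- The minimal equivalence relation `Δ` on `Sp Γ` which contains all the sets `X_a`, `a ∈ U`. -/
def Delta (m n : Sp Γ) : Prop :=
  Relation.EqvGen (fun m n : Sp Γ => ∃ a : U, Linked Γ a m.1 n.1) m n

variable (M : Type*) [AddCommGroup M] [Module U M] [Module k M] [IsScalarTower k U M]

/-- The generalized weight space `M(m) = {x ∈ M | m ^ r x = 0 for some r}`. -/
def genWeightSpace (m : Ideal Γ) : Submodule k M where
  carrier := {x | ∃ r : ℕ, ∀ z ∈ m ^ r, (z : U) • x = 0}
  zero_mem' := ⟨0, fun z _ => smul_zero _⟩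
  add_mem' := by
    rintro x y ⟨r, hr⟩ ⟨s, hs⟩
    refine ⟨max r s, fun z hz => ?_⟩
    rw [smul_add, hr z (Ideal.pow_le_pow_right (le_max_left r s) hz),
      hs z (Ideal.pow_le_pow_right (le_max_right r s) hz), add_zero]
  smul_mem' := by
    rintro c x ⟨r, hr⟩
    refine ⟨r, fun z hz => ?_⟩
    have h : (z : U) • c • x = c • (z : U) • x := by
      rw [← algebraMap_smul U c x, ← algebraMap_smul U c ((z : U) • x), smul_smul, smul_smul,
        Algebra.commutes]
    rw [h, hr z hz, smul_zero]

/-- A Harish-Chandra module for `(U, Γ)`: a finitely generated `U`-module which is the direct sum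
of the spaces `M(m)`, `m ∈ Sp Γ`. -/
structure IsHarishChandra : Prop where
  finite : Module.Finite U M
  indep : iSupIndep fun m : Sp Γ => genWeightSpace Γ M m.1
  iSup_eq_top : ⨆ m : Sp Γ, genWeightSpace Γ M m.1 = ⊤

/-- A weight module: a Harish-Chandra module such that `m x = 0` for all `x ∈ M(m)`. -/
structure IsWeightModule : Prop where
  isHarishChandra : IsHarishChandra Γ M
  diag : ∀ m : Sp Γ, ∀ x ∈ genWeightSpace Γ M m.1, ∀ z ∈ m.1, (z : U) • x = 0

/-- The support of `M`, a subset of `Sp Γ`. -/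
def Supp : Set (Sp Γ) := {m | genWeightSpace Γ M m.1 ≠ ⊥}

end Pair

/-! ### The Yangian of level `p` for `gl₂` -/

section Yangian

variable (k : Type*) [Field k] (p : ℕ)

/-- Indices of the generators: `(i, j, r)` stands for `t_{i+1, j+1}^{(r+1)}`. -/
abbrev Gen : Type := Fin 2 × Fin 2 × Fin p

/-- The element `t_{ij}^{(r)}` in the free algebra, for all `r ≥ 0`, with the conventions
`t_{ij}^{(0)} = δ_{ij}` and `t_{ij}^{(r)} = 0` for `r > p`. -/
def freeT (i j : Fin 2) (r : ℕ) : FreeAlgebra k (Gen p) :=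
  if r = 0 then (if i = j then 1 else 0)
  else if h : r - 1 < p then FreeAlgebra.ι k (i, j, ⟨r - 1, h⟩) else 0

/-- The defining relations
`[t_{ij}^{(r)}, t_{lm}^{(s)}]
  = ∑_{a=1}^{min(r,s)} (t_{lj}^{(a-1)} t_{im}^{(r+s-a)} - t_{lj}^{(r+s-a)} t_{im}^{(a-1)})`
for `1 ≤ r, s ≤ p`. -/
inductive Rel : FreeAlgebra k (Gen p) → FreeAlgebra k (Gen p) → Prop
  | comm (i j l m : Fin 2) (r s : ℕ) (hr : r ∈ Finset.Icc 1 p) (hs : s ∈ Finset.Icc 1 p) :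
      Rel (freeT k p i j r * freeT k p l m s - freeT k p l m s * freeT k p i j r)
        (∑ a ∈ Finset.Icc 1 (min r s),
          (freeT k p l j (a - 1) * freeT k p i m (r + s - a)
            - freeT k p l j (r + s - a) * freeT k p i m (a - 1)))

/-- The level `p` Yangian `Y_p(gl₂)`. -/
abbrev Y : Type _ := RingQuot (Rel k p)

/-- The elements `t_{ij}^{(r)}` of `Y_p(gl₂)`. -/
def t (i j : Fin 2) (r : ℕ) : Y k p := RingQuot.mkAlgHom k (Rel k p) (freeT k p i j r)

/-- The polynomial `T_{ij}(u) = δ_{ij} u^p + ∑_{r=1}^p t_{ij}^{(r)} u^{p-r}`. The indices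
`1, 2` are `0, 1` here. -/
def T (i j : Fin 2) : (Y k p)[X] :=
  (if i = j then X ^ p else 0) + ∑ r ∈ Finset.Icc 1 p, C (t k p i j r) * X ^ (p - r)

/-- The quantum determinant `D(u) = T₁₁(u) T₂₂(u-1) - T₂₁(u) T₁₂(u-1)`. -/
def D : (Y k p)[X] :=
  T k p 0 0 * (T k p 1 1).comp (X - 1) - T k p 1 0 * (T k p 0 1).comp (X - 1)

/-- The subalgebra `Γ` generated by the coefficients of `D(u)` and by the `t_{22}^{(r)}`. -/
def Gam : Subalgebra k (Y k p) :=
  Algebra.adjoin k (Set.range (D k p).coeff ∪ {x | ∃ r ∈ Finset.Icc 1 p, x = t k p 1 1 r})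

variable {k} {p}

/-- For a tuple `α = (α_1, …, α_n)`, the polynomial `α(u) = (u + α_1) ⋯ (u + α_n)`. -/
def tuplePoly {n : ℕ} (α : Fin n → k) : k[X] := ∏ i, (X + C (α i))

variable (β : Fin p → k) (γ : Fin (2 * p) → k)

/-- The coefficients of the polynomials `T₂₂(u) - β(u)` and `D(u) - γ(u)`. -/
def weightRelators : Set (Y k p) :=
  {x | ∃ r : ℕ, x = (T k p 1 1).coeff r - algebraMap k (Y k p) ((tuplePoly β).coeff r)
    ∨ x = (D k p).coeff r - algebraMap k (Y k p) ((tuplePoly γ).coeff r)}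

/-- The ideal of `Γ` which corresponds to `ℓ = (β, γ)`: the ideal of the point of `Sp Γ` at which
`T₂₂(u) = β(u)` and `D(u) = γ(u)`. -/
def pointIdeal : Ideal (Gam k p) := Ideal.span {z | (z : Y k p) ∈ weightRelators β γ}

/-- `D(ℓ)`: the `Δ`-equivalence class in `Sp Γ` of the point which corresponds to
`ℓ = (β, γ)`. -/
def blockClass : Set (Sp (Gam k p)) :=
  {n | ∃ m : Sp (Gam k p), m.1 = pointIdeal β γ ∧ Delta (Gam k p) m n}

/-- The genericity condition: `β_i - β_j` is not an integer for `i ≠ j`. -/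
def IsGeneric : Prop := ∀ i j : Fin p, i ≠ j → ∀ n : ℤ, β i - β j ≠ (n : k)

section Modules

variable (M : Type*) [AddCommGroup M] [Module (Y k p) M] [Module k M] [IsScalarTower k (Y k p) M]

/-- `M` has central character `γ`: the quantum determinant `D(u)`, whose coefficients generate the
centre, acts on `M` as `γ(u)`. -/
def HasCentralCharacter : Prop :=
  ∀ (x : M) (r : ℕ), (D k p).coeff r • x = (tuplePoly γ).coeff r • x

/-- The weight space of `ℓ = (β, γ)`, consisting of the `x ∈ M` with `T₂₂(u) x = β(u) x` and
`D(u) x = γ(u) x`. -/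
def weightSpace : Submodule k M where
  carrier := {x | ∀ r : ℕ, (T k p 1 1).coeff r • x = (tuplePoly β).coeff r • x ∧
    (D k p).coeff r • x = (tuplePoly γ).coeff r • x}
  zero_mem' := fun r => by simp
  add_mem' := fun {x y} hx hy r => by
    simp only [smul_add, (hx r).1, (hx r).2, (hy r).1, (hy r).2, and_self]
  smul_mem' := fun c x hx r => by
    have h : ∀ z : Y k p, z • c • x = c • z • x := fun z => by
      rw [← algebraMap_smul (Y k p) c x, ← algebraMap_smul (Y k p) c (z • x), smul_smul,
        smul_smul, Algebra.commutes]
    rw [h, h, (hx r).1, (hx r).2, smul_comm c, smul_comm c]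
    exact ⟨rfl, rfl⟩

/-- The category `R_ℓ`, `ℓ = (β, γ)`: (finitely generated) weight modules with central character
`γ` and with support in `D(ℓ)`. -/
structure IsWeightModuleIn : Prop where
  isWeightModule : IsWeightModule (Gam k p) M
  hasCentralCharacter : HasCentralCharacter γ M
  supp_subset : Supp (Gam k p) M ⊆ blockClass β γ

variable (k p) in
/-- A generic weight module: an object of `R_ℓ` for a generic `ℓ`. -/
def IsGenericWeightModule : Prop :=
  ∃ (β : Fin p → k) (γ : Fin (2 * p) → k), IsGeneric β ∧ IsWeightModuleIn β γ M

end Modules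

/-- The universal module `M(ℓ) = Y_p(gl₂) / I_ℓ`, where `I_ℓ` is the left ideal generated by the
coefficients of `T₂₂(u) - β(u)` and `D(u) - γ(u)`. -/
abbrev univModule : Type _ := Y k p ⧸ (Ideal.span (weightRelators β γ) : Ideal (Y k p))

/-- `L(ℓ)`: the quotient of `M(ℓ)` by the sum of all its proper submodules. -/
abbrev L : Type _ :=
  univModule β γ ⧸ sSup {N : Submodule (Y k p) (univModule β γ) | N ≠ ⊤}

end Yangian

end LevelYangian

end

/-! For generic ℓ = (β, γ), everything is read off from an explicit Gelfand–Tsetlin module `GT` with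
basis e_m, m ∈ ℤ^p, where e_m has weight β + m and T₂₂(u) acts on it by χ_m(u) = ∏ (u + β_i + m_i).
Genericity makes the p roots of χ_m distinct, so T₁₂(u) and T₂₁(u), of degree less than p in u, are
determined on e_m by their values at these roots. There they shift the i-th coordinate by -1 and +1.
The only constraint on the matrix elements is that raising the i-th coordinate from m_i and lowering
it again gives -γ(-(β_i + m_i)), the value forced by D(u) = γ(u).

On this space T₁₁ is defined by [t₂₁^(1), t₁₂^(r)] = t₂₂^(r) - t₁₁^(r). The relations among T₁₂,
T₂₁, T₂₂ and the identity D(u) = γ(u) are polynomial identities, by comparison of coefficients or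
checked at enough nodes (`genRel_gtB_gtB`, `gt_qdet`). The relations between T₁₁ and the other
entries follow without computation: up to scalars, the bracket of D(u) with an entry is the defect
of a missing relation times a value of T₂₂ (`qdet_bracket_b` and its companions), and here D(u) is
scalar and T₂₂ can be cancelled (`genRel_of_qdet`). Read inside the Yangian, where the defect is
zero, the same identities show that D(u) commutes with T₁₂ and T₂₁.

In any module, the values of T₁₂ and T₂₁ at the roots of a weight move weight vectors to
neighbouring weights, and D(u) fixes the round trips. So a vector of weight (β, γ) receives a
homomorphism from `GT` (`exists_gt_family`, `exists_gt_hom`), and M(ℓ) and L(ℓ) are quotients of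
`GT`. Elements of Γ separate finitely many e_m (`exists_separating`), so in every quotient of `GT`
the weight spaces are spanned by images of single e_m. This gives the weight module property and
multiplicity one. Since e_0 generates `GT`, a submodule containing a vector with nonzero
e_0-coordinate is everything. Hence `GT`, and with it M(ℓ), has a largest proper submodule, and L(ℓ)
is the only simple quotient of M(ℓ). -/

noncomputable section

namespace LevelYangian

/-! ### Vector-valued polynomial functions -/

section PolyFun

variable {k V V' : Type*} [Field k] [AddCommGroup V] [Module k V] [AddCommGroup V'] [Module k V']

/-- `f : k → V` is a polynomial function of degree less than `n`, tested on linear forms. -/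
def IsPolyFun (n : ℕ) (f : k → V) : Prop :=
  ∀ φ : Module.Dual k V, ∃ P : k[X], P.degree < n ∧ ∀ u, φ (f u) = P.eval u

lemma IsPolyFun.map {n : ℕ} {f : k → V} (hf : IsPolyFun n f) (g : V →ₗ[k] V') :
    IsPolyFun n fun u => g (f u) :=
  fun φ => hf (φ.comp g)

lemma IsPolyFun.mono {n n' : ℕ} {f : k → V} (hf : IsPolyFun n f) (h : n ≤ n') :
    IsPolyFun n' f := fun φ => by
  obtain ⟨P, hP, h'⟩ := hf φ
  exact ⟨P, hP.trans_le (by exact_mod_cast h), h'⟩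

lemma IsPolyFun.add {n : ℕ} {f g : k → V} (hf : IsPolyFun n f) (hg : IsPolyFun n g) :
    IsPolyFun n fun u => f u + g u := fun φ => by
  obtain ⟨P, hP, h⟩ := hf φ
  obtain ⟨Q, hQ, h'⟩ := hg φ
  exact ⟨P + Q, (degree_add_le _ _).trans_lt (max_lt hP hQ), fun u => by simp [h, h']⟩

lemma IsPolyFun.sub {n : ℕ} {f g : k → V} (hf : IsPolyFun n f) (hg : IsPolyFun n g) :
    IsPolyFun n fun u => f u - g u := fun φ => by
  obtain ⟨P, hP, h⟩ := hf φ
  obtain ⟨Q, hQ, h'⟩ := hg φ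
  exact ⟨P - Q, (degree_sub_le _ _).trans_lt (max_lt hP hQ), fun u => by simp [h, h']⟩

lemma IsPolyFun.neg {n : ℕ} {f : k → V} (hf : IsPolyFun n f) :
    IsPolyFun n fun u => - f u := fun φ => by
  obtain ⟨P, hP, h⟩ := hf φ
  exact ⟨-P, by rwa [degree_neg], fun u => by simp [h]⟩

lemma IsPolyFun.sum {ι : Type*} {n : ℕ} (s : Finset ι) {f : ι → k → V}
    (hf : ∀ i ∈ s, IsPolyFun n (f i)) : IsPolyFun n fun u => ∑ i ∈ s, f i u := by
  classical
  induction s using Finset.induction_on with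
  | empty => exact fun φ => ⟨0, by simp, fun u => by simp⟩
  | insert i s hi ih =>
    simp_rw [Finset.sum_insert hi]
    exact (hf i (by simp)).add (ih fun j hj => hf j (by simp [hj]))

lemma IsPolyFun.poly_smul {n d : ℕ} {f : k → V} (hf : IsPolyFun n f) {Q : k[X]}
    (hQ : Q.natDegree ≤ d) : IsPolyFun (n + d) fun u => Q.eval u • f u := fun φ => by
  obtain ⟨P, hP, h⟩ := hf φ
  refine ⟨P * Q, ?_, fun u => by simp [h, mul_comm]⟩
  by_cases hP0 : P = 0
  · simp [hP0]
  by_cases hQ0 : Q = 0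
  · simp [hQ0]
  rw [degree_mul, degree_eq_natDegree hP0, degree_eq_natDegree hQ0] at *
  have : P.natDegree < n := by exact_mod_cast hP
  exact_mod_cast (by omega : P.natDegree + Q.natDegree < n + d)

lemma isPolyFun_poly_smul {n : ℕ} {Q : k[X]} (hQ : Q.degree < n) (v : V) :
    IsPolyFun n fun u => Q.eval u • v := fun φ =>
  ⟨φ v • Q, (degree_smul_le _ _).trans_lt hQ, fun u => by simp [mul_comm]⟩

lemma IsPolyFun.smul_const {n : ℕ} {f : k → V} (hf : IsPolyFun n f) (c : k) :
    IsPolyFun n fun u => c • f u := by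
  simpa using hf.poly_smul (Q := C c) (d := 0) (by simp)

lemma IsPolyFun.sub_smul {n : ℕ} {f : k → V} (hf : IsPolyFun n f) (v : k) :
    IsPolyFun (n + 1) fun u => (u - v) • f u := by
  have := hf.poly_smul (Q := X - C v) (d := 1) (by simp)
  simp only [eval_sub, eval_X, eval_C] at this
  exact this

lemma isPolyFun_sum_pow (n : ℕ) (c : ℕ → V) :
    IsPolyFun n fun u : k => ∑ i ∈ Finset.range n, u ^ i • c i := by
  refine IsPolyFun.sum _ fun i hi => ?_
  have := isPolyFun_poly_smul (k := k) (n := n) (Q := X ^ i) (by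
    rw [degree_X_pow]; exact_mod_cast Finset.mem_range.1 hi) (c i)
  simpa using this

/-- Linear forms separate the points of a vector space over a field, so this is the root count for
scalar polynomials. -/
lemma IsPolyFun.eq_zero_of_card_le {n : ℕ} {f : k → V} (hf : IsPolyFun n f) {ι : Type*} [Fintype ι]
    (hι : n ≤ Fintype.card ι) {x : ι → k}
    (hx : Function.Injective x) (h : ∀ i, f (x i) = 0) (u : k) : f u = 0 := by
  rw [← Module.forall_dual_apply_eq_zero_iff k]
  intro φ
  obtain ⟨P, hP, h'⟩ := hf φ
  by_cases hP0 : P = 0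
  · simp [h', hP0]
  rw [h', eq_zero_of_natDegree_lt_card_of_eval_eq_zero P hx (fun i => by rw [← h', h, map_zero])
    (by rw [degree_eq_natDegree hP0] at hP; exact lt_of_lt_of_le (by exact_mod_cast hP) hι),
    eval_zero]

lemma IsPolyFun.eq_zero {n : ℕ} {f : k → V} (hf : IsPolyFun n f) {x : Fin n → k}
    (hx : Function.Injective x) (h : ∀ i, f (x i) = 0) (u : k) : f u = 0 :=
  hf.eq_zero_of_card_le (by simp) hx h u

lemma IsPolyFun.eq_zero_of_cofinite [Infinite k] {n : ℕ} {f : k → V} (hf : IsPolyFun n f)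
    (s : Set k) (hs : s.Finite) (h : ∀ u, u ∉ s → f u = 0) (u : k) : f u = 0 := by
  have : Infinite ↥(sᶜ) := hs.infinite_compl.to_subtype
  let x : Fin n → k := fun i => (Infinite.natEmbedding (↥(sᶜ)) i : k)
  refine hf.eq_zero (x := x) (fun i j hij => ?_)
    (fun i => h _ (Infinite.natEmbedding (↥(sᶜ)) i).2) u
  exact Fin.ext ((Infinite.natEmbedding (↥(sᶜ))).injective (Subtype.ext hij))

lemma coeff_eq_zero_of_sum_pow [Infinite k] {n : ℕ} {c : ℕ → V}
    (h : ∀ u : k, ∑ i ∈ Finset.range n, u ^ i • c i = 0) {i : ℕ} (hi : i < n) : c i = 0 := by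
  rw [← Module.forall_dual_apply_eq_zero_iff k]
  intro φ
  have : (∑ i ∈ Finset.range n, C (φ (c i)) * X ^ i : k[X]) = 0 := by
    refine Polynomial.funext fun u => ?_
    have := congrArg φ (h u)
    simp only [map_sum, map_smul, smul_eq_mul, map_zero] at this
    simp only [eval_finsetSum, eval_mul, eval_C, eval_pow, eval_X, eval_zero]
    rw [← this]
    exact Finset.sum_congr rfl fun i _ => mul_comm _ _
  have := congrArg (fun P => P.coeff i) this
  simpa [finsetSum_coeff, coeff_C_mul, coeff_X_pow, hi] using this

lemma coeff_eq_zero_of_sum_pow_rev [Infinite k] {n : ℕ} {c : ℕ → V}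
    (h : ∀ u : k, ∑ i ∈ Finset.range (n + 1), u ^ (n - i) • c i = 0) {i : ℕ} (hi : i ≤ n) :
    c i = 0 := by
  have key : ∀ u : k, ∑ i ∈ Finset.range (n + 1), u ^ i • c (n - i) = 0 := fun u => by
    rw [← h u, ← Finset.sum_range_reflect]
    refine Finset.sum_congr rfl fun j hj => ?_
    have := Finset.mem_range.1 hj
    congr 2
    omega
  have := coeff_eq_zero_of_sum_pow key (i := n - i) (by omega)
  rwa [Nat.sub_sub_self hi] at this

end PolyFun

/-! ### The RTT relations for generating functions -/

section RTT

variable {k A : Type*} [Field k] [Ring A] [Algebra k A] (p : ℕ)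

/-- The value at `u` of the generating polynomial of the sequence `t`. -/
def gen (t : ℕ → A) (u : k) : A := ∑ r ∈ Finset.range (p + 1), u ^ (p - r) • t r

lemma isPolyFun_gen (t : ℕ → A) : IsPolyFun (k := k) (p + 1) (gen p t) := by
  refine IsPolyFun.sum _ fun i hi => ?_
  have := isPolyFun_poly_smul (k := k) (n := p + 1) (Q := X ^ (p - i)) (by
    rw [degree_X_pow]; exact_mod_cast (by omega : p - i < p + 1)) (t i)
  simpa using this

variable {p}

/-- The two vanishing hypotheses remove the boundary terms, so an index shift is multiplication by
u. -/
lemma gen_shift_left (c : ℕ → A) (h0 : c 0 = 0) (hp : c (p + 1) = 0) (u : k) :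
    ∑ r ∈ Finset.range (p + 1), u ^ (p - r) • c (r + 1) = u • gen p c u := by
  have h1 : ∑ r ∈ Finset.range (p + 1), u ^ (p - r) • c (r + 1) =
      ∑ r ∈ Finset.range p, u ^ (p - r) • c (r + 1) := by
    rw [Finset.sum_range_succ, hp, smul_zero, add_zero]
  rw [h1, gen, Finset.sum_range_succ', h0, smul_zero, add_zero, Finset.smul_sum]
  refine Finset.sum_congr rfl fun r hr => ?_
  have := Finset.mem_range.1 hr
  rw [smul_smul, ← pow_succ']
  congr 2
  omega

/-- The two sides of the RTT relation as a recursion for coefficients. -/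
lemma sum_Icc_min_succ (f g f' g' : ℕ → A) (r s : ℕ) :
    ∑ a ∈ Finset.Icc 1 (min (r + 1) s),
        (f (a - 1) * g (r + 1 + s - a) - f' (r + 1 + s - a) * g' (a - 1)) =
      ∑ a ∈ Finset.Icc 1 (min r (s + 1)),
        (f (a - 1) * g (r + (s + 1) - a) - f' (r + (s + 1) - a) * g' (a - 1)) +
      (if r < s then f r * g s - f' s * g' r else
        if s < r then - (f s * g r - f' r * g' s) else 0) := by
  have e : r + 1 + s = r + (s + 1) := by ring
  rw [e]
  rcases lt_trichotomy r s with h | h | h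
  · rw [min_eq_left (by omega : r + 1 ≤ s), min_eq_left (by omega : r ≤ s + 1), if_pos h,
      Finset.sum_Icc_succ_top (by omega)]
    have h1 : r + (s + 1) - (r + 1) = s := by omega
    simp [h1]
  · subst h
    simp
  · rw [min_eq_right (by omega : s ≤ r + 1), min_eq_right (by omega : s + 1 ≤ r),
      if_neg (by omega), if_pos h, Finset.sum_Icc_succ_top (by omega)]
    have h1 : r + (s + 1) - (s + 1) = r := by omega
    simp only [h1, Nat.add_sub_cancel]
    abel

variable {t₁ t₂ t₃ t₄ : ℕ → A}

/-- The coefficient form of an RTT relation. Here `t₁, t₂, t₃, t₄` stand for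
`t_{ij}, t_{lm}, t_{lj}, t_{im}`. -/
def CoeffRel (t₁ t₂ t₃ t₄ : ℕ → A) : Prop :=
  ∀ r s : ℕ, t₁ r * t₂ s - t₂ s * t₁ r =
    ∑ a ∈ Finset.Icc 1 (min r s), (t₃ (a - 1) * t₄ (r + s - a) - t₃ (r + s - a) * t₄ (a - 1))

/-- The generating function form of an RTT relation. -/
def GenRel (T₁ T₂ T₃ T₄ : k → A) : Prop :=
  ∀ u v : k, (u - v) • (T₁ u * T₂ v - T₂ v * T₁ u) = T₃ u * T₄ v - T₃ v * T₄ u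

lemma gen_mul_gen (t t' : ℕ → A) (u v : k) : gen p t u * gen p t' v =
    ∑ r ∈ Finset.range (p + 1), ∑ s ∈ Finset.range (p + 1),
      (u ^ (p - r) * v ^ (p - s)) • (t r * t' s) := by
  simp only [gen, Finset.sum_mul_sum, smul_mul_smul_comm]

lemma gen_mul_gen' (t t' : ℕ → A) (u v : k) : gen p t' v * gen p t u =
    ∑ r ∈ Finset.range (p + 1), ∑ s ∈ Finset.range (p + 1),
      (u ^ (p - r) * v ^ (p - s)) • (t' s * t r) := by
  rw [gen_mul_gen, Finset.sum_comm]
  simp only [mul_comm]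

/-- Shifting r or s by one multiplies the generating function of the brackets by u or v, since
brackets with index 0 or p + 1 vanish. So the recursion [t₁ (r+1), t₂ s] - [t₁ r, t₂ (s+1)] = t₃ r
t₄ s - t₃ s t₄ r has the RTT relation as its generating function. Both passages between coefficients
and functions rest on this. -/
lemma genRel_defect (h₁ : ∀ s, Commute (t₁ 0) (t₂ s)) (h₂ : ∀ r, Commute (t₁ r) (t₂ 0))
    (z₁ : ∀ r, p < r → t₁ r = 0) (z₂ : ∀ r, p < r → t₂ r = 0) (u v : k) :
    ∑ r ∈ Finset.range (p + 1), u ^ (p - r) • ∑ s ∈ Finset.range (p + 1), v ^ (p - s) •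
      ((t₁ (r + 1) * t₂ s - t₂ s * t₁ (r + 1)) - (t₁ r * t₂ (s + 1) - t₂ (s + 1) * t₁ r)
        - (t₃ r * t₄ s - t₃ s * t₄ r)) =
    (u - v) • (gen p t₁ u * gen p t₂ v - gen p t₂ v * gen p t₁ u)
      - (gen p t₃ u * gen p t₄ v - gen p t₃ v * gen p t₄ u) := by
  set c : ℕ → ℕ → A := fun r s => t₁ r * t₂ s - t₂ s * t₁ r with hc
  have e1 : ∑ r ∈ Finset.range (p + 1), u ^ (p - r) • ∑ s ∈ Finset.range (p + 1),
      v ^ (p - s) • c (r + 1) s = u • (gen p t₁ u * gen p t₂ v - gen p t₂ v * gen p t₁ u) := by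
    have := gen_shift_left (p := p) (k := k)
      (fun r => ∑ s ∈ Finset.range (p + 1), v ^ (p - s) • c r s)
      (by simp [hc, (h₁ _).eq]) (by simp [hc, z₁]) u
    rw [this, gen_mul_gen, gen_mul_gen']
    simp only [gen, hc, Finset.smul_sum, ← Finset.sum_sub_distrib, smul_smul, ← smul_sub]
  have e2 : ∑ r ∈ Finset.range (p + 1), u ^ (p - r) • ∑ s ∈ Finset.range (p + 1),
      v ^ (p - s) • c r (s + 1) = v • (gen p t₁ u * gen p t₂ v - gen p t₂ v * gen p t₁ u) := by
    have : ∀ r, ∑ s ∈ Finset.range (p + 1), v ^ (p - s) • c r (s + 1) = v • gen p (c r) v :=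
      fun r => gen_shift_left (p := p) (k := k) (c r) (by simp [hc, (h₂ _).eq])
        (by simp [hc, z₂]) v
    simp only [this]
    rw [gen_mul_gen, gen_mul_gen']
    simp only [gen, hc, Finset.smul_sum, ← Finset.sum_sub_distrib, smul_smul, ← smul_sub]
    refine Finset.sum_congr rfl fun r _ => Finset.sum_congr rfl fun s _ => ?_
    congr 1
    ring
  have e3 : gen p t₃ u * gen p t₄ v - gen p t₃ v * gen p t₄ u =
      ∑ r ∈ Finset.range (p + 1), u ^ (p - r) • ∑ s ∈ Finset.range (p + 1),
      v ^ (p - s) • (t₃ r * t₄ s - t₃ s * t₄ r) := by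
    rw [gen_mul_gen, gen_mul_gen']
    simp only [Finset.smul_sum, ← Finset.sum_sub_distrib, smul_smul, ← smul_sub]
  rw [e3, sub_smul, ← e1, ← e2]
  simp only [smul_sub, Finset.sum_sub_distrib, hc]

lemma CoeffRel.genRel (h : CoeffRel t₁ t₂ t₃ t₄) (h₁ : ∀ s, Commute (t₁ 0) (t₂ s))
    (h₂ : ∀ r, Commute (t₁ r) (t₂ 0))
    (z₁ : ∀ r, p < r → t₁ r = 0) (z₂ : ∀ r, p < r → t₂ r = 0) :
    GenRel (k := k) (gen p t₁) (gen p t₂) (gen p t₃) (gen p t₄) := by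
  intro u v
  rw [← sub_eq_zero, ← genRel_defect h₁ h₂ z₁ z₂]
  refine Finset.sum_eq_zero fun r _ => ?_
  rw [Finset.sum_eq_zero fun s _ => ?_, smul_zero]
  rw [h, h, sum_Icc_min_succ]
  split_ifs with h1 h2
  · simp
  · simp
  · have : r = s := by omega
    subst this
    simp

lemma GenRel.coeffRel [Infinite k]
    (h : GenRel (k := k) (gen p t₁) (gen p t₂) (gen p t₃) (gen p t₄))
    (h₁ : ∀ s, Commute (t₁ 0) (t₂ s)) (h₂ : ∀ r, Commute (t₁ r) (t₂ 0))
    (z₁ : ∀ r, p < r → t₁ r = 0) (z₂ : ∀ r, p < r → t₂ r = 0)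
    (z₃ : ∀ r, p < r → t₃ r = 0) (z₄ : ∀ r, p < r → t₄ r = 0) :
    CoeffRel t₁ t₂ t₃ t₄ := by
  -- The recursion in r, which holds trivially beyond index p; within range it is a coefficient of a
  -- polynomial in u and v that vanishes everywhere on an infinite field.
  have key : ∀ r s, (t₁ (r + 1) * t₂ s - t₂ s * t₁ (r + 1)) -
      (t₁ r * t₂ (s + 1) - t₂ (s + 1) * t₁ r) - (t₃ r * t₄ s - t₃ s * t₄ r) = 0 := by
    intro r s
    by_cases hr : p < r
    · simp [z₁ r hr, z₁ (r + 1) (by omega), z₃ r hr, z₄ r hr]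
    by_cases hs : p < s
    · simp [z₂ s hs, z₂ (s + 1) (by omega), z₃ s hs, z₄ s hs]
    have step : ∀ v : k, ∑ s ∈ Finset.range (p + 1), v ^ (p - s) •
        ((t₁ (r + 1) * t₂ s - t₂ s * t₁ (r + 1)) - (t₁ r * t₂ (s + 1) - t₂ (s + 1) * t₁ r)
        - (t₃ r * t₄ s - t₃ s * t₄ r)) = 0 := fun v =>
      coeff_eq_zero_of_sum_pow_rev (k := k) (n := p) (c := fun r => ∑ s ∈ Finset.range (p + 1),
        v ^ (p - s) • ((t₁ (r + 1) * t₂ s - t₂ s * t₁ (r + 1)) -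
          (t₁ r * t₂ (s + 1) - t₂ (s + 1) * t₁ r) - (t₃ r * t₄ s - t₃ s * t₄ r)))
        (fun u => by rw [genRel_defect h₁ h₂ z₁ z₂, h u v, sub_self]) (by omega)
    exact coeff_eq_zero_of_sum_pow_rev (k := k) (n := p) (c := fun s =>
      (t₁ (r + 1) * t₂ s - t₂ s * t₁ (r + 1)) -
          (t₁ r * t₂ (s + 1) - t₂ (s + 1) * t₁ r) - (t₃ r * t₄ s - t₃ s * t₄ r)) step (by omega)
  intro r
  induction r with
  | zero => intro s; simp [(h₁ s).eq]
  | succ r ih =>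
    intro s
    have := key r s
    rw [ih (s + 1), sub_sub, sub_eq_zero] at this
    rw [this, sum_Icc_min_succ]
    congr 1
    split_ifs with h1 h2
    · rfl
    · abel
    · have : r = s := by omega
      subst this
      simp

end RTT

/-! ### The quantum determinant: formal commutation identities -/

section Formal

variable {k A : Type*} [Field k] [Ring A] [Algebra k A] {a b c d : k → A}

/-- Exchanging the factors on the left yields T₃ v T₄ u - T₃ u T₄ v on the right; the symmetry
assumed for the bracket of T₄ with T₃ allows these products to be reordered. -/
lemma GenRel.swap_of_symm {T₁ T₂ T₃ T₄ : k → A} (h : GenRel T₁ T₂ T₃ T₄)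
    (h' : ∀ u v, T₄ u * T₃ v - T₃ v * T₄ u = T₄ v * T₃ u - T₃ u * T₄ v) :
    GenRel T₂ T₁ T₄ T₃ := by
  intro u v
  have e := h v u
  have e' := h' u v
  linear_combination (norm := module) e - e'

/-- The right side of the relation is antisymmetric in u and v and so is the factor u - v, so the
bracket is symmetric. -/
lemma GenRel.symm_bracket {T₁ T₂ T₃ T₄ : k → A} (h : GenRel T₁ T₂ T₃ T₄) (u v : k) :
    T₁ u * T₂ v - T₂ v * T₁ u = T₁ v * T₂ u - T₂ u * T₁ v := by
  rcases eq_or_ne u v with rfl | huv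
  · rfl
  · refine smul_right_injective A (sub_ne_zero.2 huv) ?_
    dsimp only
    linear_combination (norm := module) h u v + h v u

/-- The relation between a and b is not assumed: its defect appears on the right. The identity can
thus be read in two directions. A vanishing defect makes D(u) commute with b(v), and a scalar D(u)
makes the defect vanish once d is cancelled. The next two lemmas play the same role for c and d. -/
lemma qdet_bracket_b (hb : ∀ u v, b u * b v = b v * b u) (hdb : GenRel d b b d)
    (hcb : GenRel c b a d) (u v : k) :
    ((u - v) * (u - v - 1)) • ((a u * d (u - 1) - c u * b (u - 1)) * b v
        - b v * (a u * d (u - 1) - c u * b (u - 1))) =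
      (u - v - 1) • (((u - v) • (a u * b v - b v * a u) - (a u * b v - a v * b u)) * d (u - 1)) := by
  have h1 := congrArg (a u * ·) (hdb (u - 1) v)
  have h2 := congrArg (a v * ·) (hdb u (u - 1))
  have h3 := congrArg (a u * ·) (hdb v (u - 1))
  have h4 := congrArg (· * b (u - 1)) (hcb u v)
  have h5 := congrArg (c u * ·) (hb (u - 1) v)
  simp only [mul_sub, sub_mul, mul_smul_comm, smul_mul_assoc, mul_assoc, smul_sub] at *
  linear_combination (norm := module) (u - v) • h1 + (u - v - 1) • h2 + h3 - (u - v - 1) • h4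
    - ((u-v)*(u-v-1)) • h5

lemma qdet_bracket_c (hc : ∀ u v, c u * c v = c v * c u) (hcd : GenRel c d c d)
    (hcb : GenRel c b a d) (u v : k) :
    ((u - v) * (u - v + 1)) • ((a u * d (u + 1) - b u * c (u + 1)) * c v
        - c v * (a u * d (u + 1) - b u * c (u + 1))) =
      (u - v + 1) • (((u - v) • (a u * c v - c v * a u) - (a v * c u - a u * c v)) * d (u + 1)) := by
  have h1 := congrArg (a u * ·) (hcd v (u + 1))
  have h2 := congrArg (a v * ·) (hcd (u + 1) u)
  have h3 := congrArg (a u * ·) (hcd (u + 1) v)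
  have h4 := congrArg (· * c (u + 1)) (hcb v u)
  have h5 := congrArg (b u * ·) (hc (u + 1) v)
  simp only [mul_sub, sub_mul, mul_smul_comm, smul_mul_assoc, mul_assoc, smul_sub] at *
  linear_combination (norm := module) (u - v) • h1 + (u - v + 1) • h2 - h3 - (u - v + 1) • h4
    - ((u - v) * (u - v + 1)) • h5

lemma qdet_bracket_d (hd : ∀ u v, d u * d v = d v * d u) (hdb : GenRel d b b d)
    (hcd : GenRel c d c d) (u v : k) :
    ((u - v) * (u - v - 1)) • ((a u * d (u - 1) - c u * b (u - 1)) * d v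
        - d v * (a u * d (u - 1) - c u * b (u - 1))) =
      (u - v - 1) • (((u - v) • (a u * d v - d v * a u) - (c u * b v - c v * b u)) * d (u - 1)) := by
  have h1 := congrArg (a u * ·) (hd (u - 1) v)
  have h2 := congrArg (· * b (u - 1)) (hcd u v)
  have h3 := congrArg (c v * ·) (hdb u (u - 1))
  have h4 := congrArg (c u * ·) (hdb v (u - 1))
  simp only [mul_sub, sub_mul, mul_smul_comm, smul_mul_assoc, mul_assoc, smul_sub] at *
  linear_combination (norm := module) ((u - v) * (u - v - 1)) • h1 - (u - v - 1) • h2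
    + (u - v - 1) • h3 - (u - v - 1) • h4

/-- Here the mixed relations of a are already available, and the remaining defect is the bracket of
a with itself. -/
lemma qdet_bracket_a (had : GenRel a d c b) (hab : GenRel a b a b) (hac : GenRel a c c a)
    (u v : k) :
    (v - u + 1) • ((a u * d (u - 1) - c u * b (u - 1)) * a v
        - a v * (a u * d (u - 1) - c u * b (u - 1))) =
      (v - u + 1) • ((a u * a v - a v * a u) * d (u - 1)) := by
  have h1 := congrArg (a u * ·) (had v (u - 1))
  have h2 := congrArg (c u * ·) (hab v (u - 1))
  have h3 := congrArg (· * b v) (hac u (u - 1))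
  have h4 := congrArg (· * b (u - 1)) (hac v u)
  have h5 := congrArg (· * b (u - 1)) (hac.symm_bracket u v)
  simp only [mul_sub, sub_mul, mul_smul_comm, smul_mul_assoc, mul_assoc, smul_sub] at *
  linear_combination (norm := module) -h1 + h2 + h3 + h4 - h5

end Formal

/-! ### Gelfand–Tsetlin operators -/

section Model

variable {k : Type*} [Field k] {p : ℕ}

lemma isPolyFun_gen_of_zero {A : Type*} [Ring A] [Algebra k A] {t : ℕ → A} (h : t 0 = 0) :
    IsPolyFun (k := k) p (gen p t) := by
  have e : gen (k := k) p t = fun u => ∑ r ∈ Finset.range p, u ^ (p - (r + 1)) • t (r + 1) := by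
    funext u
    rw [gen, Finset.sum_range_succ', h, smul_zero, add_zero]
  rw [e]
  refine IsPolyFun.sum _ fun i hi => ?_
  have hi := Finset.mem_range.1 hi
  have := isPolyFun_poly_smul (k := k) (n := p) (Q := X ^ (p - (i + 1))) (by
    rw [degree_X_pow]; exact_mod_cast (by omega : p - (i + 1) < p)) (t (i + 1))
  simpa using this

/-- A polynomial of degree less than n in each variable is determined by its values on an n × n
grid. The grid used is that of the roots of a weight polynomial. -/
lemma eq_zero_of_grid {V : Type*} [AddCommGroup V] [Module k V] {n : ℕ} {f : k → k → V}
    (hf : ∀ v, IsPolyFun n fun u => f u v) (hf' : ∀ u, IsPolyFun n (f u)) {x : Fin n → k}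
    (hx : Function.Injective x) (h : ∀ i j, f (x i) (x j) = 0) (u v : k) : f u v = 0 :=
  (hf v).eq_zero hx (fun i => (hf' (x i)).eq_zero hx (h i) v) u

lemma sum_pow_coeff_eq_eval {P : k[X]} (hP : P.natDegree ≤ p) (u : k) :
    ∑ r ∈ Finset.range (p + 1), u ^ (p - r) * P.coeff (p - r) = P.eval u := by
  rw [eval_eq_sum_range' (Nat.lt_succ_of_le hP), ← Finset.sum_range_reflect]
  refine Finset.sum_congr rfl fun r hr => ?_
  have := Finset.mem_range.1 hr
  rw [Nat.add_sub_cancel, mul_comm, Nat.sub_sub_self (by omega)]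

variable (β : Fin p → k)

/-- The shifted weight `β + m`. -/
def shift (m : Fin p → ℤ) : Fin p → k := fun i => β i + (m i : k)

lemma shift_zero : shift β 0 = β := by
  funext i; simp [shift]

lemma shift_injective {β : Fin p → k} (hβ : IsGeneric β) (m : Fin p → ℤ) :
    Function.Injective fun i => -shift β m i := by
  intro i j hij
  by_contra hne
  refine hβ i j hne (m j - m i) ?_
  simp only [shift, neg_inj] at hij
  push_cast
  linear_combination hij

lemma tuplePoly_monic {n : ℕ} (α : Fin n → k) : (tuplePoly α).Monic :=
  monic_prod_of_monic _ _ fun _ _ => monic_X_add_C _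

lemma tuplePoly_natDegree {n : ℕ} (α : Fin n → k) : (tuplePoly α).natDegree = n := by
  rw [tuplePoly, natDegree_prod_of_monic _ _ fun _ _ => monic_X_add_C _]
  simp

lemma tuplePoly_eval {n : ℕ} (α : Fin n → k) (u : k) : (tuplePoly α).eval u = ∏ i, (u + α i) := by
  simp [tuplePoly, eval_prod]

/-- The polynomial `α(u)` with the factor `u + α_i` left out. -/
def cofactor (α : Fin p → k) (i : Fin p) : k[X] := ∏ j ∈ Finset.univ.erase i, (X + C (α j))

lemma eval_tuplePoly_eq_mul_cofactor (α : Fin p → k) (i : Fin p) (u : k) :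
    (tuplePoly α).eval u = (u + α i) * (cofactor α i).eval u := by
  rw [tuplePoly, cofactor, ← Finset.mul_prod_erase _ _ (Finset.mem_univ i)]
  simp

lemma cofactor_natDegree (α : Fin p → k) (i : Fin p) : (cofactor α i).natDegree = p - 1 := by
  rw [cofactor, natDegree_prod_of_monic _ _ fun _ _ => monic_X_add_C _]
  simp

lemma cofactor_eval (α : Fin p → k) (i : Fin p) (u : k) :
    (cofactor α i).eval u = ∏ j ∈ Finset.univ.erase i, (u + α j) := by
  simp [cofactor, eval_prod]

lemma cofactor_shift_add (m : Fin p → ℤ) (i : Fin p) (c : ℤ) :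
    cofactor (shift β (m + Pi.single i c)) i = cofactor (shift β m) i := by
  refine Finset.prod_congr rfl fun j hj => ?_
  simp [shift, Pi.single_eq_of_ne (Finset.ne_of_mem_erase hj)]

lemma eval_tuplePoly_shift_add (m : Fin p → ℤ) (i : Fin p) (c : ℤ) (u : k) :
    (tuplePoly (shift β (m + Pi.single i c))).eval u =
      (u + shift β m i + c) * (cofactor (shift β m) i).eval u := by
  rw [eval_tuplePoly_eq_mul_cofactor _ i, cofactor_shift_add]
  simp [shift, add_assoc]

lemma cofactor_eval_ne_zero {β : Fin p → k} (hβ : IsGeneric β) (m : Fin p → ℤ) (i : Fin p) :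
    (cofactor (shift β m) i).eval (-shift β m i) ≠ 0 := by
  rw [cofactor_eval, Finset.prod_ne_zero_iff]
  intro j hj h
  refine Finset.ne_of_mem_erase hj (shift_injective hβ m ?_)
  linear_combination -h

lemma cofactor_eval_eq_zero (α : Fin p → k) {i j : Fin p} (hij : i ≠ j) :
    (cofactor α i).eval (-α j) = 0 := by
  rw [cofactor_eval]
  exact Finset.prod_eq_zero (Finset.mem_erase.2 ⟨hij.symm, Finset.mem_univ j⟩) (by simp)

/-- The Lagrange basis polynomial at the node `-α_i` among the nodes `-α_1, …, -α_p`. -/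
def lagr (α : Fin p → k) (i : Fin p) : k[X] :=
  C ((cofactor α i).eval (-α i))⁻¹ * cofactor α i

lemma lagr_eval (α : Fin p → k) (i : Fin p) (u : k) :
    (lagr α i).eval u = ((cofactor α i).eval (-α i))⁻¹ * (cofactor α i).eval u := by
  simp [lagr]

lemma lagr_degree (α : Fin p → k) (i : Fin p) : (lagr α i).degree < p := by
  have h1 : (lagr α i).natDegree ≤ p - 1 :=
    (natDegree_C_mul_le _ _).trans (cofactor_natDegree α i).le
  have := i.pos
  exact degree_le_natDegree.trans_lt (by exact_mod_cast (by omega))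

/-- The underlying space of the Gelfand–Tsetlin module. -/
abbrev GTSpace (k : Type*) [Field k] (p : ℕ) : Type _ := (Fin p → ℤ) →₀ k

/-- The basis vector of weight `β + m`. -/
abbrev gtBasis (k : Type*) [Field k] {p : ℕ} (m : Fin p → ℤ) : GTSpace k p := Finsupp.single m 1

lemma gt_ext {V : Type*} [AddCommGroup V] [Module k V] {F G : GTSpace k p →ₗ[k] V}
    (h : ∀ m, F (gtBasis k m) = G (gtBasis k m)) : F = G :=
  Finsupp.lhom_ext' fun m => LinearMap.ext_ring (h m)

/-- The coefficients of `T₂₂(u)`. -/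
def gtD (r : ℕ) : Module.End k (GTSpace k p) :=
  if r ≤ p then
    Finsupp.linearCombination k fun m => (tuplePoly (shift β m)).coeff (p - r) • gtBasis k m
  else 0

variable (al : Fin p → ℤ → k)

/-- The coefficients of an operator which shifts weights by `c` in one coordinate, with matrix
elements `al`; they are those of `T₁₂(u)` for `c = -1` and of `T₂₁(u)` for `c = 1`. -/
def gtB (c : ℤ) (r : ℕ) : Module.End k (GTSpace k p) :=
  if r ≤ p then
    Finsupp.linearCombination k fun m =>
      ∑ i, ((lagr (shift β m) i).coeff (p - r) * al i (m i)) • gtBasis k (m + Pi.single i c)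
  else 0

lemma gen_gtD_apply (u : k) (m : Fin p → ℤ) :
    gen p (gtD β) u (gtBasis k m) = (tuplePoly (shift β m)).eval u • gtBasis k m := by
  rw [gen, LinearMap.sum_apply, ← sum_pow_coeff_eq_eval (tuplePoly_natDegree _).le,
    Finset.sum_smul]
  refine Finset.sum_congr rfl fun r hr => ?_
  have : r ≤ p := Nat.lt_succ_iff.1 (Finset.mem_range.1 hr)
  rw [gtD, if_pos this, LinearMap.smul_apply, Finsupp.linearCombination_single, one_smul, smul_smul]

lemma gen_gtB_apply (c : ℤ) (u : k) (m : Fin p → ℤ) :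
    gen p (gtB β al c) u (gtBasis k m) =
      ∑ i, ((lagr (shift β m) i).eval u * al i (m i)) • gtBasis k (m + Pi.single i c) := by
  have : ∀ r ∈ Finset.range (p + 1), (u ^ (p - r) • gtB β al c r) (gtBasis k m) =
      ∑ i, (u ^ (p - r) * (lagr (shift β m) i).coeff (p - r) * al i (m i)) •
        gtBasis k (m + Pi.single i c) := fun r hr => by
    have : r ≤ p := Nat.lt_succ_iff.1 (Finset.mem_range.1 hr)
    rw [gtB, if_pos this, LinearMap.smul_apply, Finsupp.linearCombination_single, one_smul,
      Finset.smul_sum]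
    simp only [smul_smul, mul_assoc]
  rw [gen, LinearMap.sum_apply, Finset.sum_congr rfl this, Finset.sum_comm]
  refine Finset.sum_congr rfl fun i _ => ?_
  rw [← Finset.sum_smul, ← Finset.sum_mul,
    sum_pow_coeff_eq_eval (natDegree_le_of_degree_le (lagr_degree _ i).le)]

lemma gtD_zero : gtD β 0 = 1 := gt_ext fun m => by
  have h := (tuplePoly_monic (shift β m)).coeff_natDegree
  rw [tuplePoly_natDegree] at h
  simp [gtD, h]

lemma gtB_zero (c : ℤ) : gtB β al c 0 = 0 := gt_ext fun m => by
  have : ∀ i, (lagr (shift β m) i).coeff p = 0 := fun i => coeff_eq_zero_of_degree_lt (lagr_degree _ i)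
  simp [gtB, this]

lemma gtD_of_lt {r : ℕ} (h : p < r) : gtD β r = 0 := if_neg (by omega)

lemma gtB_of_lt (c : ℤ) {r : ℕ} (h : p < r) : gtB β al c r = 0 := if_neg (by omega)

variable {β}

/-- At a root of the weight polynomial all Lagrange basis polynomials but one vanish, so a single
shift survives. -/
lemma gen_gtB_node (hβ : IsGeneric β) (c : ℤ) (m : Fin p → ℤ) (i : Fin p) :
    gen p (gtB β al c) (-shift β m i) (gtBasis k m) =
      al i (m i) • gtBasis k (m + Pi.single i c) := by
  rw [gen_gtB_apply, Finset.sum_eq_single i]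
  · rw [lagr_eval, inv_mul_cancel₀ (cofactor_eval_ne_zero hβ m i), one_mul]
  · intro j _ hj
    rw [lagr_eval, cofactor_eval_eq_zero _ hj, mul_zero, zero_mul, zero_smul]
  · simp

lemma shift_add_single_of_ne {m : Fin p → ℤ} {i j : Fin p} (hij : i ≠ j) (c : ℤ) :
    shift β (m + Pi.single j c) i = shift β m i := by
  simp [shift, Pi.single_eq_of_ne hij]

lemma gen_gtB_node_of_ne (hβ : IsGeneric β) (c c' : ℤ) (m : Fin p → ℤ) {i j : Fin p} (hij : i ≠ j) :
    gen p (gtB β al c) (-shift β m i) (gtBasis k (m + Pi.single j c')) =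
      al i (m i) • gtBasis k (m + Pi.single j c' + Pi.single i c) := by
  have := gen_gtB_node al hβ c (m + Pi.single j c') i
  rw [shift_add_single_of_ne hij] at this
  rw [this]
  simp [Pi.single_eq_of_ne hij]

lemma gen_gtB_comm_node (hβ : IsGeneric β) (al' : Fin p → ℤ → k) (c c' : ℤ) (m : Fin p → ℤ)
    {i j : Fin p} (hij : i ≠ j) :
    gen p (gtB β al c) (-shift β m i) (gen p (gtB β al' c') (-shift β m j) (gtBasis k m)) =
      gen p (gtB β al' c') (-shift β m j) (gen p (gtB β al c) (-shift β m i) (gtBasis k m)) := by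
  rw [gen_gtB_node al' hβ, gen_gtB_node al hβ, map_smul, map_smul,
    gen_gtB_node_of_ne _ hβ _ _ _ hij, gen_gtB_node_of_ne _ hβ _ _ _ hij.symm, smul_comm,
    add_right_comm]

lemma isPolyFun_apply {t : ℕ → Module.End k (GTSpace k p)} {n : ℕ}
    (h : IsPolyFun (k := k) n (gen p t)) (w : GTSpace k p) : IsPolyFun n fun u : k => gen p t u w :=
  h.map (LinearMap.applyₗ w)

lemma gen_gtD_comm (u v : k) :
    gen (k := k) p (gtD β) u * gen p (gtD β) v = gen p (gtD β) v * gen p (gtD β) u := gt_ext fun m => by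
  simp only [Module.End.mul_apply, gen_gtD_apply, map_smul]
  rw [smul_comm]

/-- Both sides have degree less than p in u and in v. On the grid of nodes the diagonal is trivial,
and shifts of different coordinates commute because the matrix elements of one coordinate do not
depend on the others. -/
lemma gen_gtB_comm (hβ : IsGeneric β) (c : ℤ) (u v : k) :
    gen (k := k) p (gtB β al c) u * gen p (gtB β al c) v =
      gen p (gtB β al c) v * gen p (gtB β al c) u := by
  refine gt_ext fun m => ?_
  have hb := isPolyFun_gen_of_zero (k := k) (p := p) (t := gtB β al c) (gtB_zero β al c)
  rw [← sub_eq_zero]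
  refine eq_zero_of_grid (n := p) (f := fun u v => gen p (gtB β al c) u (gen p (gtB β al c) v
    (gtBasis k m)) - gen p (gtB β al c) v (gen p (gtB β al c) u (gtBasis k m)))
    (fun v => ?_) (fun u => ?_) (shift_injective hβ m) (fun i j => ?_) u v
  · exact (isPolyFun_apply hb _).sub ((isPolyFun_apply hb _).map _)
  · exact ((isPolyFun_apply hb _).map _).sub (isPolyFun_apply hb _)
  · rcases eq_or_ne i j with rfl | hij
    · exact sub_self _
    · exact sub_eq_zero.2 (gen_gtB_comm_node _ hβ _ _ _ _ hij)

/-- Compared along each shift separately, the identity concerns only the factor u + β_i + m_i of the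
weight polynomial, as the cofactor is unchanged by the shift. -/
lemma genRel_gtD_gtB :
    GenRel (k := k) (gen p (gtD β)) (gen p (gtB β al (-1))) (gen p (gtB β al (-1)))
      (gen p (gtD β)) := by
  intro u v
  refine gt_ext fun m => ?_
  simp only [LinearMap.smul_apply, LinearMap.sub_apply, Module.End.mul_apply, gen_gtD_apply,
    map_smul, gen_gtB_apply, map_sum, Finset.smul_sum, ← Finset.sum_sub_distrib, smul_smul,
    ← sub_smul]
  refine Finset.sum_congr rfl fun i _ => ?_
  rw [eval_tuplePoly_shift_add, eval_tuplePoly_eq_mul_cofactor _ i,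
    eval_tuplePoly_eq_mul_cofactor _ i, lagr_eval, lagr_eval]
  congr 1
  push_cast
  ring

lemma genRel_gtB_gtD :
    GenRel (k := k) (gen p (gtB β al 1)) (gen p (gtD β)) (gen p (gtB β al 1))
      (gen p (gtD β)) := by
  intro u v
  refine gt_ext fun m => ?_
  simp only [LinearMap.smul_apply, LinearMap.sub_apply, Module.End.mul_apply, gen_gtD_apply,
    map_smul, gen_gtB_apply, map_sum, Finset.smul_sum, ← Finset.sum_sub_distrib, smul_smul,
    ← sub_smul]
  refine Finset.sum_congr rfl fun i _ => ?_
  rw [eval_tuplePoly_shift_add, eval_tuplePoly_eq_mul_cofactor _ i,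
    eval_tuplePoly_eq_mul_cofactor _ i, lagr_eval, lagr_eval]
  congr 1
  push_cast
  ring

end Model

/-! ### The remaining relations on the Gelfand–Tsetlin space -/

section Model

variable {k : Type*} [Field k] {p : ℕ}

/-- Removing the leading term u^(p-1) t₁ lowers the degree; this exposes the top coefficient
cancelled in `genRel_gtB_gtB`. -/
lemma isPolyFun_gen_sub {A : Type*} [Ring A] [Algebra k A] {t : ℕ → A} (h : t 0 = 0) (hp : 0 < p) :
    IsPolyFun (k := k) (p - 1) fun u => gen p t u - u ^ (p - 1) • t 1 := by
  obtain ⟨q, rfl⟩ : ∃ q, p = q + 1 := ⟨p - 1, by omega⟩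
  have e : (fun u : k => gen (q + 1) t u - u ^ (q + 1 - 1) • t 1) =
      fun u => ∑ r ∈ Finset.range q, u ^ (q + 1 - (r + 2)) • t (r + 2) := by
    funext u
    rw [gen, Finset.sum_range_succ', h, smul_zero, add_zero, Finset.sum_range_succ']
    simp
  rw [e]
  refine IsPolyFun.sum _ fun i hi => ?_
  have hi := Finset.mem_range.1 hi
  have := isPolyFun_poly_smul (k := k) (n := q) (Q := X ^ (q + 1 - (i + 2))) (by
    rw [degree_X_pow]; exact_mod_cast (by omega : q + 1 - (i + 2) < q)) (t (i + 2))
  simpa using this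

lemma gen_sub_bracket {A : Type*} [Ring A] [Algebra k A] (d b : ℕ → A) (x : A) (u : k) :
    gen p (fun r => d r - (x * b r - b r * x)) u =
      gen p d u - (x * gen p b u - gen p b u * x) := by
  simp only [gen, smul_sub, Finset.sum_sub_distrib, Finset.mul_sum, Finset.sum_mul,
    mul_smul_comm, smul_mul_assoc]

lemma sub_bracket_zero {A : Type*} [Ring A] (d x : A) : d - (x * 0 - 0 * x) = d := by simp

variable (β : Fin p → k) (al be : Fin p → ℤ → k)

/-- The coefficients of `T₁₁(u)`. -/
def gtA (r : ℕ) : Module.End k (GTSpace k p) :=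
  gtD β r - (gtB β be 1 1 * gtB β al (-1) r - gtB β al (-1) r * gtB β be 1 1)

lemma gtA_zero : gtA β al be 0 = 1 := by
  rw [gtA, gtB_zero β al, gtD_zero]
  exact sub_bracket_zero (A := Module.End k (GTSpace k p)) _ _

lemma gtA_of_lt {r : ℕ} (h : p < r) : gtA β al be r = 0 := by
  rw [gtA, gtB_of_lt β al _ h, gtD_of_lt β h]
  exact sub_bracket_zero (A := Module.End k (GTSpace k p)) _ _

lemma gen_gtA (u : k) : gen p (gtA β al be) u = gen p (gtD β) u -
    (gtB β be 1 1 * gen p (gtB β al (-1)) u - gen p (gtB β al (-1)) u * gtB β be 1 1) :=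
  gen_sub_bracket _ _ _ u

variable {β}

lemma gen_gtA_apply (u : k) (m : Fin p → ℤ) : gen p (gtA β al be) u (gtBasis k m) =
    (tuplePoly (shift β m)).eval u • gtBasis k m -
    (gtB β be 1 1 (gen p (gtB β al (-1)) u (gtBasis k m)) -
      gen p (gtB β al (-1)) u (gtB β be 1 1 (gtBasis k m))) := by
  rw [gen_gtA, LinearMap.sub_apply, gen_gtD_apply]
  rfl

/-- A grid argument again: at two different nodes both brackets vanish, and at equal nodes the sides
coincide. -/
lemma gtBracket_symm (hβ : IsGeneric β) (u v : k) (m : Fin p → ℤ) :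
    gen p (gtB β be 1) u (gen p (gtB β al (-1)) v (gtBasis k m)) -
        gen p (gtB β al (-1)) v (gen p (gtB β be 1) u (gtBasis k m)) =
      gen p (gtB β be 1) v (gen p (gtB β al (-1)) u (gtBasis k m)) -
        gen p (gtB β al (-1)) u (gen p (gtB β be 1) v (gtBasis k m)) := by
  have hb := isPolyFun_gen_of_zero (k := k) (p := p) (t := gtB β al (-1)) (gtB_zero β al (-1))
  have hc := isPolyFun_gen_of_zero (k := k) (p := p) (t := gtB β be 1) (gtB_zero β be 1)
  rw [← sub_eq_zero]
  refine eq_zero_of_grid (n := p) (f := fun u v =>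
    gen p (gtB β be 1) u (gen p (gtB β al (-1)) v (gtBasis k m)) -
        gen p (gtB β al (-1)) v (gen p (gtB β be 1) u (gtBasis k m)) -
      (gen p (gtB β be 1) v (gen p (gtB β al (-1)) u (gtBasis k m)) -
        gen p (gtB β al (-1)) u (gen p (gtB β be 1) v (gtBasis k m))))
    (fun v => ?_) (fun u => ?_) (shift_injective hβ m) (fun i j => ?_) u v
  · exact ((isPolyFun_apply hc _).sub ((isPolyFun_apply hc _).map _)).sub
      (((isPolyFun_apply hb _).map _).sub (isPolyFun_apply hb _))
  · exact (((isPolyFun_apply hb _).map _).sub (isPolyFun_apply hb _)).sub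
      ((isPolyFun_apply hc _).sub ((isPolyFun_apply hc _).map _))
  · rcases eq_or_ne i j with rfl | hij
    · exact sub_self _
    · exact (congrArg₂ (· - ·) (sub_eq_zero.2 (gen_gtB_comm_node be hβ al 1 (-1) m hij))
        (sub_eq_zero.2 (gen_gtB_comm_node be hβ al 1 (-1) m hij.symm))).trans (sub_self 0)

lemma degree_sub_lt_of_monic {P Q : k[X]} {n : ℕ} (hP : P.Monic) (hQ : Q.Monic)
    (hP' : P.natDegree = n) (hQ' : Q.natDegree = n) : (P - Q).degree < n := by
  have := degree_sub_lt_left (p := P) (q := Q) (by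
    rw [degree_eq_natDegree hP.ne_zero, degree_eq_natDegree hQ.ne_zero, hP', hQ']) hP.ne_zero
    (by rw [hP, hQ])
  rwa [degree_eq_natDegree hP.ne_zero, hP'] at this

/-- On a basis vector the difference of the two sides is f(u, v). It a priori has degree p in u, but
its leading coefficient cancels: that is how T₁₁ was defined. So f has degree less than p in u, by
antisymmetry also in v, and it vanishes on the grid of nodes. -/
lemma genRel_gtB_gtB (hβ : IsGeneric β) (hp : 0 < p) :
    GenRel (k := k) (gen p (gtB β be 1)) (gen p (gtB β al (-1))) (gen p (gtA β al be))
      (gen p (gtD β)) := by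
  intro u v
  refine gt_ext fun m => ?_
  have hb := isPolyFun_gen_of_zero (k := k) (p := p) (t := gtB β al (-1)) (gtB_zero β al (-1))
  set x := gtB β be 1 1 with hx
  set χ := tuplePoly (shift β m) with hχ
  let S : k → k → GTSpace k p := fun u v =>
    gen p (gtB β be 1) u (gen p (gtB β al (-1)) v (gtBasis k m)) -
      gen p (gtB β al (-1)) v (gen p (gtB β be 1) u (gtBasis k m))
  let Z : k → GTSpace k p := fun u =>
    x (gen p (gtB β al (-1)) u (gtBasis k m)) - gen p (gtB β al (-1)) u (x (gtBasis k m))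
  let f : k → k → GTSpace k p := fun u v =>
    (u - v) • S u v + χ.eval v • Z u - χ.eval u • Z v
  have hZ : IsPolyFun p Z := ((isPolyFun_apply hb _).map _).sub (isPolyFun_apply hb _)
  have hf : ∀ v, IsPolyFun p fun u => f u v := by
    intro v
    let R : k → GTSpace k p := fun u =>
      (gen p (gtB β be 1) u - u ^ (p - 1) • x) (gen p (gtB β al (-1)) v (gtBasis k m)) -
      gen p (gtB β al (-1)) v ((gen p (gtB β be 1) u - u ^ (p - 1) • x) (gtBasis k m))
    have hR : IsPolyFun (p - 1) R := by
      have h := isPolyFun_gen_sub (k := k) (p := p) (t := gtB β be 1) (gtB_zero β be 1) hp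
      exact (h.map (LinearMap.applyₗ _)).sub ((h.map (LinearMap.applyₗ _)).map _)
    have hR' := hR.sub_smul v
    rw [Nat.sub_add_cancel hp] at hR'
    have hdeg : ((X - C v) * X ^ (p - 1) - χ).degree < (p : WithBot ℕ) := by
      refine degree_sub_lt_of_monic ((monic_X_sub_C v).mul (monic_X_pow _)) (tuplePoly_monic _)
        ?_ (tuplePoly_natDegree _)
      rw [(monic_X_sub_C v).natDegree_mul (monic_X_pow _), natDegree_X_sub_C, natDegree_X_pow]
      omega
    -- Splitting off u^(p-1) x from T₂₁(u) leaves (u - v) u^(p-1) - χ(u), a difference of two monic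
    -- polynomials of degree p, as the coefficient of Z v.
    have e : (fun u => f u v) = fun u =>
        ((X - C v) * X ^ (p - 1) - χ).eval u • Z v + (u - v) • R u + χ.eval v • Z u := by
      funext u
      simp only [f, R, Z, S, LinearMap.sub_apply, LinearMap.smul_apply, map_sub, map_smul, eval_sub,
        eval_mul, eval_X, eval_C, eval_pow]
      module
    rw [e]
    exact ((isPolyFun_poly_smul hdeg _).add hR').add (hZ.smul_const _)
  have hanti : ∀ u v, f u v = - f v u := by
    intro u v
    have : S u v = S v u := gtBracket_symm al be hβ u v m
    simp only [f, this]
    module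
  have hf' : ∀ u, IsPolyFun p (f u) := by
    intro u
    have : f u = fun v => - f v u := funext fun v => hanti u v
    rw [this]
    exact (hf u).neg
  have hroot : ∀ i, χ.eval (-shift β m i) = 0 := fun i => by
    rw [hχ, eval_tuplePoly_eq_mul_cofactor _ i, neg_add_cancel, zero_mul]
  have key : f u v = 0 := by
    refine eq_zero_of_grid hf hf' (shift_injective hβ m) (fun i j => ?_) u v
    simp only [f, hroot, zero_smul, add_zero, sub_zero]
    rcases eq_or_ne i j with rfl | hij
    · rw [sub_self, zero_smul]
    · simp only [S]
      rw [gen_gtB_comm_node _ hβ _ _ _ _ hij, sub_self, smul_zero]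
  simp only [LinearMap.smul_apply, LinearMap.sub_apply, Module.End.mul_apply, gen_gtD_apply,
    map_smul, gen_gtA_apply]
  simp only [f, Z, S] at key
  rw [← sub_eq_zero, ← key]
  module

/-- The quantum determinant acts as `γ(u)` on the Gelfand–Tsetlin space. -/
lemma gt_qdet [CharZero k] (hβ : IsGeneric β) (hp : 0 < p) (γ : Fin (2 * p) → k)
    (hab : ∀ i n, al i (n + 1) * be i n = - (tuplePoly γ).eval (-(β i + n))) (u : k) :
    gen p (gtA β al be) u * gen p (gtD β) (u - 1) -
      gen p (gtB β be 1) u * gen p (gtB β al (-1)) (u - 1) = (tuplePoly γ).eval u • 1 := by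
  refine gt_ext fun m => ?_
  have hb := isPolyFun_gen_of_zero (k := k) (p := p) (t := gtB β al (-1)) (gtB_zero β al (-1))
  have hc := isPolyFun_gen_of_zero (k := k) (p := p) (t := gtB β be 1) (gtB_zero β be 1)
  set χ := tuplePoly (shift β m) with hχ
  have hχdeg : (χ.comp (X - C 1)).natDegree = p := by
    rw [natDegree_comp, natDegree_X_sub_C, mul_one, hχ, tuplePoly_natDegree]
  have hχmon : (χ.comp (X - C 1)).Monic :=
    (tuplePoly_monic _).comp (monic_X_sub_C _) (by
    rw [natDegree_X_sub_C]; exact one_ne_zero)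
  have hroot : ∀ i, χ.eval (-shift β m i) = 0 := fun i => by
    rw [hχ, eval_tuplePoly_eq_mul_cofactor _ i, neg_add_cancel, zero_mul]
  let f : k → GTSpace k p := fun u =>
    χ.eval (u - 1) • gen p (gtA β al be) u (gtBasis k m) -
      gen p (gtB β be 1) u (gen p (gtB β al (-1)) (u - 1) (gtBasis k m)) -
      (tuplePoly γ).eval u • gtBasis k m
  -- The terms χ(u-1) χ(u) and γ(u) are both monic of degree 2p, so their difference drops in
  -- degree.
  have hf : IsPolyFun (p + p) f := by
    have e : f = fun u => (χ.comp (X - C 1) * χ - tuplePoly γ).eval u • gtBasis k m -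
        (χ.comp (X - C 1)).eval u • (gtB β be 1 1 (gen p (gtB β al (-1)) u (gtBasis k m)) -
          gen p (gtB β al (-1)) u (gtB β be 1 1 (gtBasis k m))) -
        ∑ i, ((lagr (shift β m) i).comp (X - C 1)).eval u •
          al i (m i) • gen p (gtB β be 1) u (gtBasis k (m + Pi.single i (-1))) := by
      funext u
      simp only [f, gen_gtA_apply, gen_gtB_apply β al (-1) (u - 1), eval_sub, eval_mul, eval_comp,
        eval_X, eval_C, map_sum, map_smul, mul_smul]
      module
    rw [e]
    refine IsPolyFun.sub (IsPolyFun.sub ?_ ?_) (IsPolyFun.sum _ fun i _ => ?_)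
    · refine isPolyFun_poly_smul (n := p + p) (degree_sub_lt_of_monic (hχmon.mul
        (tuplePoly_monic _)) (tuplePoly_monic _) ?_ ?_) _
      · rw [hχmon.natDegree_mul (tuplePoly_monic _), hχdeg, tuplePoly_natDegree]
      · rw [tuplePoly_natDegree, two_mul]
    · exact IsPolyFun.poly_smul (((isPolyFun_apply hb _).map _).sub (isPolyFun_apply hb _)) hχdeg.le
    · refine IsPolyFun.poly_smul ((isPolyFun_apply hc _).smul_const _) ?_
      rw [natDegree_comp, natDegree_X_sub_C, mul_one]
      exact natDegree_le_of_degree_le (lagr_degree _ i).le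
  -- Degree less than 2p is met by 2p points: the roots of χ(u) and those of χ(u-1). Genericity
  -- makes them distinct.
  have key : f u = 0 := by
    refine hf.eq_zero_of_card_le (ι := Fin p ⊕ Fin p) (by simp)
      (x := Sum.elim (fun i => -shift β m i) (fun i => -shift β m i + 1)) ?_ ?_ u
    · have hne : ∀ i j, -shift β m i ≠ -shift β m j + 1 := by
        intro i j h
        rcases eq_or_ne i j with rfl | hij
        · simp at h
        · refine hβ i j hij (m j - m i - 1) ?_
          simp only [shift] at h
          push_cast
          linear_combination -h
      rintro (i | i) (j | j) h
      · exact congrArg _ (shift_injective hβ m h)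
      · exact (hne _ _ h).elim
      · exact (hne _ _ h.symm).elim
      · exact congrArg _ (shift_injective hβ m (add_right_cancel h))
    · rintro (i | i)
      -- At a root of χ(u), the relation at arguments u and u - 1 replaces the determinant by
      -- -T₁₂(u-1) T₂₁(u), because T₂₂(u) kills the basis vector. The product of matrix elements is
      -- then `hab` at n = m_i.
      · have h := congrArg (· (gtBasis k m)) (genRel_gtB_gtB al be hβ hp (-shift β m i)
          (-shift β m i - 1))
        simp only [LinearMap.sub_apply, Module.End.mul_apply, gen_gtD_apply,
          map_smul, sub_sub_cancel, one_smul] at h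
        rw [← hχ, hroot, zero_smul, sub_zero] at h
        simp only [Sum.elim_inl, f]
        rw [← h, sub_sub_cancel_left, gen_gtB_node _ hβ, map_smul]
        have h2 := gen_gtB_node al hβ (-1) (m + Pi.single i 1) i
        have e : -shift β (m + Pi.single i 1) i = -shift β m i - 1 := by
          simp [shift]; ring
        rw [e] at h2
        rw [h2]
        have e2 : m + Pi.single i 1 + Pi.single i (-1) = m := by
          rw [add_assoc, ← Pi.single_add]; simp
        have := hab i (m i)
        rw [e2, smul_smul, ← neg_smul, ← sub_smul]
        simp only [Pi.add_apply, Pi.single_eq_same]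
        rw [mul_comm, this]
        simp [shift]
      -- At a root of χ(u-1) the first term of the determinant vanishes, and the second is a
      -- lowering followed by a raising: `hab` at n = m_i - 1.
      · simp only [Sum.elim_inr, f, add_sub_cancel_right, hroot, zero_smul, zero_sub]
        rw [gen_gtB_node _ hβ, map_smul]
        have h2 := gen_gtB_node be hβ 1 (m + Pi.single i (-1)) i
        have e : -shift β (m + Pi.single i (-1)) i = -shift β m i + 1 := by
          simp [shift]; ring
        rw [e] at h2
        rw [h2]
        have e2 : m + Pi.single i (-1) + Pi.single i 1 = m := by
          rw [add_assoc, ← Pi.single_add]; simp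
        have := hab i (m i - 1)
        rw [e2, smul_smul, ← neg_smul, ← sub_smul]
        simp only [Pi.add_apply, Pi.single_eq_same]
        rw [← sub_eq_add_neg]
        rw [sub_add_cancel] at this
        rw [this]
        simp only [shift]
        push_cast
        rw [neg_neg, sub_eq_zero.2, zero_smul]
        congr 1
        ring
  simp only [LinearMap.sub_apply, Module.End.mul_apply, gen_gtD_apply, map_smul,
    LinearMap.smul_apply, Module.End.one_apply]
  exact sub_eq_zero.1 key

end Model

/-! ### Recovering the relations of T₁₁ from a scalar quantum determinant -/

section Formal

variable {k A : Type*} [Field k] [Ring A] [Algebra k A] {a b c d : k → A}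

lemma IsPolyFun.mul_right {n : ℕ} {f : k → A} (hf : IsPolyFun n f) (x : A) :
    IsPolyFun n fun u => f u * x := hf.map (LinearMap.mulRight k x)

lemma IsPolyFun.mul_left {n : ℕ} {f : k → A} (hf : IsPolyFun n f) (x : A) :
    IsPolyFun n fun u => x * f u := hf.map (LinearMap.mulLeft k x)

lemma IsPolyFun.bracket {n : ℕ} {f : k → A} (hf : IsPolyFun n f) (x : A) :
    IsPolyFun n fun u => f u * x - x * f u := (hf.mul_right x).sub (hf.mul_left x)

lemma GenRel.symm_bracket' {T₁ T₂ T₃ T₄ : k → A} (h : GenRel T₁ T₂ T₃ T₄) (u v : k) :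
    T₂ u * T₁ v - T₁ v * T₂ u = T₂ v * T₁ u - T₁ u * T₂ v := by
  rw [← neg_sub, h.symm_bracket v u, neg_sub]

lemma GenRel.of_commute {T : k → A} (h : ∀ u v, T u * T v = T v * T u) : GenRel T T T T := by
  intro u v
  rw [h u v, sub_self, smul_zero]

/-- If the quantum determinant is scalar and the values of `T₂₂` can be cancelled, the relations
that do not involve `T₁₁` and the definition of `T₁₁` imply all the RTT relations. -/
lemma genRel_of_qdet {n : ℕ} (ha : IsPolyFun n a) (hb' : IsPolyFun n b) (hc' : IsPolyFun n c)
    (cancel : ∀ (F : k → A) (e : k) (N : ℕ), IsPolyFun N F →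
      ∀ s : Set k, s.Finite → (∀ u, u ∉ s → F u * d (u + e) = 0) → ∀ u, F u = 0)
    (hb : ∀ u v, b u * b v = b v * b u) (hc : ∀ u v, c u * c v = c v * c u)
    (hd : ∀ u v, d u * d v = d v * d u)
    (hdb : GenRel d b b d) (hcd : GenRel c d c d) (hcb : GenRel c b a d) (γ : k → k)
    (hD : ∀ u, a u * d (u - 1) - c u * b (u - 1) = γ u • 1) :
    GenRel a d c b ∧ GenRel a b a b ∧ GenRel a c c a ∧ ∀ u v, a u * a v = a v * a u := by
  -- The second expression of the determinant, from the relation of c and b at arguments differing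
  -- by 1. It fits `qdet_bracket_c`.
  have hD' : ∀ u, a u * d (u + 1) - b u * c (u + 1) = γ (u + 1) • 1 := by
    intro u
    have h1 := hcb (u + 1) u
    have h2 := hD (u + 1)
    simp only [add_sub_cancel_left, add_sub_cancel_right, one_smul] at h1 h2
    rw [← h2]
    linear_combination (norm := module) h1
  have had : GenRel a d c b := by
    intro u v
    rw [← sub_eq_zero]
    -- A scalar determinant has zero bracket, so the defect times d(u-1) vanishes wherever u - v - 1
    -- ≠ 0; `cancel` removes d and fills in the exceptional point.
    refine cancel (fun u => (u - v) • (a u * d v - d v * a u) - (c u * b v - c v * b u)) (-1)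
      (n + 1) ?_ {v + 1} (Set.finite_singleton _) (fun u hu => ?_) u
    · exact ((ha.bracket _).sub_smul v).sub
        (((hc'.mul_right _).sub (hb'.mul_left _)).mono (Nat.le_succ n))
    · rw [← sub_eq_add_neg]
      have h := qdet_bracket_d (a := a) hd hdb hcd u v
      simp only [hD, smul_mul_assoc, mul_smul_comm, one_mul, mul_one, sub_self, smul_zero] at h
      refine (smul_eq_zero.1 h.symm).resolve_left fun h0 => hu ?_
      rw [Set.mem_singleton_iff]
      linear_combination h0
  have hab : GenRel a b a b := by
    intro u v
    rw [← sub_eq_zero]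
    refine cancel (fun u => (u - v) • (a u * b v - b v * a u) - (a u * b v - a v * b u)) (-1)
      (n + 1) ?_ {v + 1} (Set.finite_singleton _) (fun u hu => ?_) u
    · exact ((ha.bracket _).sub_smul v).sub
        (((ha.mul_right _).sub (hb'.mul_left _)).mono (Nat.le_succ n))
    · rw [← sub_eq_add_neg]
      have h := qdet_bracket_b hb hdb hcb u v
      simp only [hD, smul_mul_assoc, mul_smul_comm, one_mul, mul_one, sub_self, smul_zero] at h
      refine (smul_eq_zero.1 h.symm).resolve_left fun h0 => hu ?_
      rw [Set.mem_singleton_iff]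
      linear_combination h0
  have hac' : ∀ u v, (u - v) • (a u * c v - c v * a u) = a v * c u - a u * c v := by
    intro u v
    rw [← sub_eq_zero]
    refine cancel (fun u => (u - v) • (a u * c v - c v * a u) - (a v * c u - a u * c v)) 1
      (n + 1) ?_ {v - 1} (Set.finite_singleton _) (fun u hu => ?_) u
    · exact ((ha.bracket _).sub_smul v).sub
        (((hc'.mul_left _).sub (ha.mul_right _)).mono (Nat.le_succ n))
    · have h := qdet_bracket_c hc hcd hcb u v
      simp only [hD', smul_mul_assoc, mul_smul_comm, one_mul, mul_one, sub_self, smul_zero] at h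
      refine (smul_eq_zero.1 h.symm).resolve_left fun h0 => hu ?_
      rw [Set.mem_singleton_iff]
      linear_combination h0
  -- The defect produced by the determinant orders the products with a first. Symmetry of the
  -- bracket of a and c puts them in the RTT order.
  have hac : GenRel a c c a := by
    intro u v
    have h : a u * c v - c v * a u = a v * c u - c u * a v := by
      rcases eq_or_ne u v with rfl | huv
      · rfl
      · refine smul_right_injective A (sub_ne_zero.2 huv) ?_
        linear_combination (norm := module) hac' u v + hac' v u
    linear_combination (norm := module) hac' u v - h
  refine ⟨had, hab, hac, fun u v => ?_⟩
  rw [← sub_eq_zero]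
  refine cancel (fun u => a u * a v - a v * a u) (-1) n (ha.bracket _) {v + 1}
    (Set.finite_singleton _) (fun u hu => ?_) u
  rw [← sub_eq_add_neg]
  have h := qdet_bracket_a had hab hac u v
  simp only [hD, smul_mul_assoc, mul_smul_comm, one_mul, mul_one, sub_self, smul_zero] at h
  refine (smul_eq_zero.1 h.symm).resolve_left fun h0 => hu ?_
  rw [Set.mem_singleton_iff]
  linear_combination -h0

/-- All RTT relations from those for one ordering of each pair of matrix entries. -/
lemma genRel_matrix (had : GenRel a d c b) (hab : GenRel a b a b) (hac : GenRel a c c a)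
    (ha : ∀ u v, a u * a v = a v * a u) (hb : ∀ u v, b u * b v = b v * b u)
    (hc : ∀ u v, c u * c v = c v * c u) (hd : ∀ u v, d u * d v = d v * d u)
    (hdb : GenRel d b b d) (hcd : GenRel c d c d) (hcb : GenRel c b a d) (i j l m : Fin 2) :
    GenRel (![![a, b], ![c, d]] i j) (![![a, b], ![c, d]] l m) (![![a, b], ![c, d]] l j)
      (![![a, b], ![c, d]] i m) := by
  fin_cases i <;> fin_cases j <;> fin_cases l <;> fin_cases m
  · exact .of_commute ha
  · exact hab
  · exact hac
  · exact had
  · exact hab.swap_of_symm hab.symm_bracket'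
  · exact .of_commute hb
  · exact hcb.swap_of_symm had.symm_bracket'
  · exact hdb.swap_of_symm hdb.symm_bracket
  · exact hac.swap_of_symm hac.symm_bracket
  · exact hcb
  · exact .of_commute hc
  · exact hcd
  · exact had.swap_of_symm hcb.symm_bracket'
  · exact hdb
  · exact hcd.swap_of_symm hcd.symm_bracket'
  · exact .of_commute hd

end Formal

/-! ### The Gelfand–Tsetlin module -/

section Model

variable {k : Type*} [Field k] {p : ℕ} (β : Fin p → k) (al be : Fin p → ℤ → k)

/-- The coefficients of the matrix entries `T_{ij}(u)` on the Gelfand–Tsetlin space. -/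
def gtT (i j : Fin 2) : ℕ → Module.End k (GTSpace k p) :=
  ![![gtA β al be, gtB β al (-1)], ![gtB β be 1, gtD β]] i j

lemma gtT_zero (i j : Fin 2) : gtT β al be i j 0 = if i = j then 1 else 0 := by
  fin_cases i <;> fin_cases j
  · exact gtA_zero β al be
  · exact gtB_zero β al (-1)
  · exact gtB_zero β be 1
  · exact gtD_zero β

lemma gtT_of_lt (i j : Fin 2) {r : ℕ} (h : p < r) : gtT β al be i j r = 0 := by
  fin_cases i <;> fin_cases j
  · exact gtA_of_lt β al be h
  · exact gtB_of_lt β al (-1) h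
  · exact gtB_of_lt β be 1 h
  · exact gtD_of_lt β h

-- T₂₂(u + e) multiplies each basis vector by a nonzero polynomial in u, so it can be cancelled for
-- all but finitely many u, and F is polynomial in u.
open Classical in
lemma gt_cancel [CharZero k] (F : k → Module.End k (GTSpace k p)) (e : k) (N : ℕ)
    (hF : IsPolyFun N F) (s : Set k) (hs : s.Finite)
    (h : ∀ u, u ∉ s → F u * gen p (gtD β) (u + e) = 0) (u : k) : F u = 0 := by
  refine gt_ext fun m => ?_
  have hP : (tuplePoly (shift β m)).comp (X + C e) ≠ 0 :=
    ((tuplePoly_monic (shift β m)).comp_X_add_C e).ne_zero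
  refine (hF.map (LinearMap.applyₗ (gtBasis k m))).eq_zero_of_cofinite
    (s ∪ ↑((tuplePoly (shift β m)).comp (X + C e)).roots.toFinset)
    (hs.union (Finset.finite_toSet _)) (fun u hu => ?_) u
  rw [Set.mem_union, not_or] at hu
  have h1 := congrArg (· (gtBasis k m)) (h u hu.1)
  simp only [Module.End.mul_apply, gen_gtD_apply, map_smul, LinearMap.zero_apply] at h1
  refine (smul_eq_zero.1 h1).resolve_left fun h0 => hu.2 ?_
  rw [Finset.mem_coe, Multiset.mem_toFinset, mem_roots hP, IsRoot, eval_comp]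
  simpa using h0

variable {β al be}

lemma coeffRel_gtT [CharZero k] (hβ : IsGeneric β) (hp : 0 < p) (γ : Fin (2 * p) → k)
    (hab : ∀ i n, al i (n + 1) * be i n = - (tuplePoly γ).eval (-(β i + n))) (i j l m : Fin 2) :
    CoeffRel (gtT β al be i j) (gtT β al be l m) (gtT β al be l j) (gtT β al be i m) := by
  obtain ⟨h1, h2, h3, h4⟩ := genRel_of_qdet (k := k) (isPolyFun_gen p (gtA β al be))
    (isPolyFun_gen p (gtB β al (-1))) (isPolyFun_gen p (gtB β be 1)) (gt_cancel β)
    (gen_gtB_comm al hβ (-1)) (gen_gtB_comm be hβ 1) gen_gtD_comm (genRel_gtD_gtB al)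
    (genRel_gtB_gtD be) (genRel_gtB_gtB al be hβ hp) (fun u => (tuplePoly γ).eval u)
    (gt_qdet al be hβ hp γ hab)
  have h := genRel_matrix h1 h2 h3 h4 (gen_gtB_comm al hβ (-1)) (gen_gtB_comm be hβ 1)
    gen_gtD_comm (genRel_gtD_gtB al) (genRel_gtB_gtD be) (genRel_gtB_gtB al be hβ hp) i j l m
  have e : ∀ i j, (![![gen (k := k) p (gtA β al be), gen p (gtB β al (-1))],
      ![gen p (gtB β be 1), gen p (gtD β)]] i j) = gen p (gtT β al be i j) := by
    intro i j
    fin_cases i <;> fin_cases j <;> rfl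
  rw [e, e, e, e] at h
  refine h.coeffRel (fun s => ?_) (fun r => ?_) (fun r => gtT_of_lt _ _ _ _ _)
    (fun r => gtT_of_lt _ _ _ _ _) (fun r => gtT_of_lt _ _ _ _ _) (fun r => gtT_of_lt _ _ _ _ _)
  · rw [gtT_zero]; split_ifs
    exacts [Commute.one_left _, Commute.zero_left _]
  · rw [gtT_zero]; split_ifs
    exacts [Commute.one_right _, Commute.zero_right _]

end Model

/-! ### Generating functions in the Yangian -/

section Yangian

variable {k : Type*} [Field k] {p : ℕ}

lemma t_zero (i j : Fin 2) : t k p i j 0 = if i = j then 1 else 0 := by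
  rw [t, freeT, if_pos rfl]
  split_ifs <;> simp

lemma freeT_of_lt (i j : Fin 2) {r : ℕ} (h : p < r) : freeT k p i j r = 0 := by
  rw [freeT, if_neg (by omega), dif_neg (by omega)]

lemma t_of_lt (i j : Fin 2) {r : ℕ} (h : p < r) : t k p i j r = 0 := by
  rw [t, freeT_of_lt i j h, map_zero]

/-- The presentation covers 1 ≤ r, s ≤ p. Outside this range both sides vanish, since a ≤ min(r, s)
gives r + s - a ≥ max(r, s). -/
lemma coeffRel_t (i j l m : Fin 2) :
    CoeffRel (t k p i j) (t k p l m) (t k p l j) (t k p i m) := by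
  intro r s
  rcases Nat.eq_zero_or_pos r with rfl | hr
  · rw [t_zero]
    split_ifs <;> simp
  rcases Nat.eq_zero_or_pos s with rfl | hs
  · rw [t_zero l m]
    split_ifs <;> simp
  by_cases hrp : p < r
  · rw [t_of_lt i j hrp, zero_mul, mul_zero, sub_zero]
    refine (Finset.sum_eq_zero fun a ha => ?_).symm
    obtain ⟨ha, ha'⟩ := Finset.mem_Icc.1 ha
    have := ha'.trans (min_le_right r s)
    rw [t_of_lt i m (r := r + s - a) (by omega), t_of_lt l j (r := r + s - a) (by omega), mul_zero, zero_mul, sub_self]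
  by_cases hsp : p < s
  · rw [t_of_lt l m hsp, zero_mul, mul_zero, sub_zero]
    refine (Finset.sum_eq_zero fun a ha => ?_).symm
    obtain ⟨ha, ha'⟩ := Finset.mem_Icc.1 ha
    have := ha'.trans (min_le_left r s)
    rw [t_of_lt i m (r := r + s - a) (by omega), t_of_lt l j (r := r + s - a) (by omega), mul_zero, zero_mul, sub_self]
  have := RingQuot.mkAlgHom_rel k (Rel.comm (k := k) (p := p) i j l m r s
    (Finset.mem_Icc.2 ⟨hr, by omega⟩) (Finset.mem_Icc.2 ⟨hs, by omega⟩))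
  simp only [map_sub, map_mul, map_sum] at this
  exact this

lemma commute_t_zero (i j : Fin 2) (x : Y k p) : Commute (t k p i j 0) x := by
  rw [t_zero]
  split_ifs
  exacts [Commute.one_left _, Commute.zero_left _]

/-- The value `T_{ij}(u)` of the generating polynomial at `u`. -/
abbrev Tval (i j : Fin 2) (u : k) : Y k p := gen p (t k p i j) u

lemma genRel_Tval (i j l m : Fin 2) :
    GenRel (k := k) (A := Y k p) (Tval i j) (Tval l m) (Tval l j) (Tval i m) :=
  (coeffRel_t i j l m).genRel (fun _ => commute_t_zero _ _ _) (fun _ => (commute_t_zero _ _ _).symm)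
    (fun _ => t_of_lt _ _) (fun _ => t_of_lt _ _)

/-- Evaluation of polynomials over the Yangian at a scalar. -/
def evalAt (u : k) : (Y k p)[X] →+* Y k p :=
  eval₂RingHom' (RingHom.id _) (algebraMap k _ u) fun a => (Algebra.commutes u a).symm

lemma evalAt_X (u : k) : evalAt (p := p) u X = algebraMap k _ u := by
  simp [evalAt, eval₂RingHom']

lemma evalAt_C (u : k) (y : Y k p) : evalAt u (C y) = y := by
  simp [evalAt, eval₂RingHom']

lemma evalAt_sub (u : k) (P Q : (Y k p)[X]) : evalAt u (P - Q) = evalAt u P - evalAt u Q :=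
  map_sub (evalAt u) P Q

lemma evalAt_eq_sum (u : k) (P : (Y k p)[X]) {n : ℕ} (hn : P.natDegree < n) :
    evalAt u P = ∑ i ∈ Finset.range n, u ^ i • P.coeff i := by
  have : evalAt u P = P.eval (algebraMap k _ u) := rfl
  rw [this, eval_eq_sum_range' hn]
  refine Finset.sum_congr rfl fun i _ => ?_
  rw [← map_pow, ← Algebra.commutes, Algebra.smul_def]

lemma gen_eq_sum_Icc (i j : Fin 2) (u : k) : Tval (p := p) i j u =
    (if i = j then algebraMap k _ (u ^ p) else 0) +
      ∑ r ∈ Finset.Icc 1 p, t k p i j r * algebraMap k _ (u ^ (p - r)) := by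
  have e : Finset.range (p + 1) = insert 0 (Finset.Icc 1 p) := by
    ext r; simp only [Finset.mem_range, Finset.mem_insert, Finset.mem_Icc]; omega
  rw [Tval, gen, e, Finset.sum_insert (by simp), t_zero]
  congr 1
  · split_ifs
    · rw [Nat.sub_zero, Algebra.algebraMap_eq_smul_one]
    · rw [smul_zero]
  · refine Finset.sum_congr rfl fun r _ => ?_
    rw [← Algebra.commutes, Algebra.smul_def]

lemma evalAt_T (i j : Fin 2) (u : k) : evalAt u (T k p i j) = Tval i j u := by
  rw [gen_eq_sum_Icc, T, map_add, map_sum]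
  simp only [map_mul, evalAt_C, map_pow, evalAt_X]
  split_ifs <;> simp [evalAt_X]

lemma evalAt_T_comp (i j : Fin 2) (u : k) :
    evalAt u ((T k p i j).comp (X - 1)) = Tval i j (u - 1) := by
  have : evalAt (p := p) u (X - 1) = algebraMap k _ (u - 1) := by
    rw [evalAt_sub, evalAt_X, map_one, map_sub, map_one]
  rw [gen_eq_sum_Icc, T, add_comp, Polynomial.sum_comp, map_add, map_sum]
  simp only [C_mul_comp, X_pow_comp, map_mul, evalAt_C, map_pow, this]
  split_ifs <;> simp [this]

/-- The value `D(u)` of the quantum determinant at `u`. -/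
abbrev Dval (u : k) : Y k p :=
  Tval 0 0 u * Tval 1 1 (u - 1) - Tval 1 0 u * Tval 0 1 (u - 1)

lemma evalAt_D (u : k) : evalAt u (D k p) = Dval u := by
  rw [D, evalAt_sub, map_mul, map_mul, evalAt_T, evalAt_T, evalAt_T_comp, evalAt_T_comp]

/-- The RTT relation for T₂₁ and T₁₂ at arguments u and u - 1, where the factor u - v is 1. -/
lemma Dval_eq (u : k) : (Dval u : Y k p) =
    Tval 0 0 (u - 1) * Tval 1 1 u - Tval 0 1 (u - 1) * Tval 1 0 u := by
  have h := genRel_Tval (k := k) (p := p) 1 0 0 1 u (u - 1)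
  rw [sub_sub_cancel, one_smul] at h
  rw [Dval]
  linear_combination (norm := noncomm_ring) -h

/-- For the bracket B(u, v), the relation at (u, v) and at (v, u) gives (u - v) B = B and (u - v) B
= -B, so 2B = 0 with no exceptional arguments. -/
lemma commute_Tval_self [CharZero k] (i j : Fin 2) (u v : k) :
    Tval (p := p) i j u * Tval i j v = Tval i j v * Tval i j u := by
  have h := genRel_Tval (k := k) (p := p) i j i j
  have h1 := h u v
  have h2 := h v u
  rw [← sub_eq_zero]
  refine (smul_eq_zero.1 (?_ : (2 : k) •
    (Tval (p := p) i j u * Tval i j v - Tval i j v * Tval i j u) = 0)).resolve_left two_ne_zero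
  linear_combination (norm := module) h2 - h1

variable {V : Type*} [AddCommGroup V] [Module (Y k p) V] [Module k V] [IsScalarTower k (Y k p) V]

lemma coeff_smul_eq_iff [Infinite k] (P : (Y k p)[X]) (q : k[X]) (x : V) :
    (∀ r, P.coeff r • x = q.coeff r • x) ↔ ∀ u : k, evalAt u P • x = q.eval u • x := by
  set n := max P.natDegree q.natDegree + 1 with hn
  have key : ∀ u : k, evalAt u P • x - q.eval u • x =
      ∑ i ∈ Finset.range n, u ^ i • (P.coeff i • x - q.coeff i • x) := by
    intro u
    rw [evalAt_eq_sum u P (n := n) (by omega), eval_eq_sum_range' (n := n) (by omega),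
      Finset.sum_smul, Finset.sum_smul, ← Finset.sum_sub_distrib]
    refine Finset.sum_congr rfl fun i _ => ?_
    rw [smul_sub, smul_assoc, smul_smul, mul_comm]
  constructor
  · intro h u
    rw [← sub_eq_zero, key]
    exact Finset.sum_eq_zero fun i _ => by rw [h, sub_self, smul_zero]
  · intro h r
    by_cases hr : r < n
    · exact sub_eq_zero.1 (coeff_eq_zero_of_sum_pow (fun u => by rw [← key, h, sub_self]) hr)
    · rw [coeff_eq_zero_of_natDegree_lt (by omega), coeff_eq_zero_of_natDegree_lt (by omega),
        zero_smul, zero_smul]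

lemma mem_weightSpace_iff [Infinite k] {α : Fin p → k} {γ : Fin (2 * p) → k} {x : V} :
    x ∈ weightSpace α γ V ↔ (∀ u : k, (Tval 1 1 u : Y k p) • x = (tuplePoly α).eval u • x) ∧
      ∀ u : k, (Dval u : Y k p) • x = (tuplePoly γ).eval u • x := by
  simp_rw [← evalAt_T, ← evalAt_D, ← coeff_smul_eq_iff, ← forall_and]
  rfl

lemma hasCentralCharacter_iff [Infinite k] {γ : Fin (2 * p) → k} :
    HasCentralCharacter γ V ↔
      ∀ (x : V) (u : k), (Dval u : Y k p) • x = (tuplePoly γ).eval u • x := by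
  simp_rw [← evalAt_D, ← coeff_smul_eq_iff]
  rfl

/-- The Yangian is generated by the coefficients of `T₁₂`, `T₂₁` and `T₂₂`. -/
lemma subalgebra_eq_top (S : Subalgebra k (Y k p)) (hb : ∀ r, t k p 0 1 r ∈ S)
    (hc : ∀ r, t k p 1 0 r ∈ S) (hd : ∀ r, t k p 1 1 r ∈ S) : S = ⊤ := by
  have ha : ∀ r, t k p 0 0 r ∈ S := by
    intro r
    rcases Nat.eq_zero_or_pos r with rfl | hr
    · rw [t_zero]; exact S.one_mem
    have h := coeffRel_t (k := k) (p := p) 1 0 0 1 1 r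
    rw [min_eq_left hr] at h
    simp only [Finset.Icc_self, Finset.sum_singleton, Nat.sub_self, t_zero, if_true,
      one_mul, mul_one, add_tsub_cancel_left] at h
    have : t k p 0 0 r = t k p 1 1 r -
        (t k p 1 0 1 * t k p 0 1 r - t k p 0 1 r * t k p 1 0 1) := by rw [h]; abel
    rw [this]
    exact S.sub_mem (hd _) (S.sub_mem (S.mul_mem (hc _) (hb _)) (S.mul_mem (hb _) (hc _)))
  have hall : ∀ i j r, t k p i j r ∈ S := by
    intro i j r
    fin_cases i <;> fin_cases j
    exacts [ha r, hb r, hc r, hd r]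
  rw [eq_top_iff]
  rintro y -
  obtain ⟨x, rfl⟩ := RingQuot.mkAlgHom_surjective k (Rel k p) y
  induction x using FreeAlgebra.induction with
  | grade0 c => rw [AlgHom.commutes]; exact S.algebraMap_mem c
  | grade1 g =>
    obtain ⟨i, j, r⟩ := g
    have := hall i j (r + 1)
    rw [t, freeT, if_neg (by omega), dif_pos (by simp)] at this
    simpa using this
  | mul x y hx hy => rw [map_mul]; exact S.mul_mem hx hy
  | add x y hx hy => rw [map_add]; exact S.add_mem hx hy

end Yangian

/-! ### Ladder operators on weight vectors of Yangian modules -/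

section Ladder

variable {k : Type*} [Field k] {p : ℕ}

lemma isPolyFun_Dval : ∃ N, IsPolyFun (k := k) N fun u => (Dval u : Y k p) := by
  refine ⟨(D k p).natDegree + 1, ?_⟩
  have e : (fun u => (Dval u : Y k p)) =
      fun u => ∑ i ∈ Finset.range ((D k p).natDegree + 1), u ^ i • (D k p).coeff i := by
    funext u
    rw [← evalAt_D, evalAt_eq_sum u _ (Nat.lt_succ_self _)]
  rw [e]
  exact isPolyFun_sum_pow _ _

/-- The defect in `qdet_bracket_b` vanishes in the Yangian. This settles u ≠ v, v + 1, and
polynomiality in u gives the rest. -/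
lemma commute_Dval_b [CharZero k] (u v : k) : (Dval u : Y k p) * Tval 0 1 v = Tval 0 1 v * Dval u := by
  obtain ⟨N, hN⟩ := isPolyFun_Dval (k := k) (p := p)
  rw [← sub_eq_zero]
  refine (hN.bracket (Tval 0 1 v)).eq_zero_of_cofinite {v, v + 1} (by simp) (fun u hu => ?_) u
  simp only [Set.mem_insert_iff, Set.mem_singleton_iff, not_or] at hu
  have h := qdet_bracket_b (k := k) (A := Y k p) (commute_Tval_self 0 1) (genRel_Tval 1 1 0 1)
    (genRel_Tval 1 0 0 1) u v
  rw [genRel_Tval 0 0 0 1 u v, sub_self, zero_mul, smul_zero] at h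
  refine (smul_eq_zero.1 h).resolve_left (mul_ne_zero (sub_ne_zero.2 hu.1) fun h0 => hu.2 ?_)
  linear_combination h0

lemma commute_Dval_c [CharZero k] (u v : k) : (Dval u : Y k p) * Tval 1 0 v = Tval 1 0 v * Dval u := by
  obtain ⟨N, hN⟩ := isPolyFun_Dval (k := k) (p := p)
  rw [← sub_eq_zero]
  refine (hN.bracket (Tval 1 0 v)).eq_zero_of_cofinite {v + 1, v} (by simp) (fun u hu => ?_) u
  simp only [Set.mem_insert_iff, Set.mem_singleton_iff, not_or] at hu
  have h := qdet_bracket_c (k := k) (A := Y k p) (commute_Tval_self 1 0) (genRel_Tval 1 0 1 1)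
    (genRel_Tval 1 0 0 1) (u - 1) v
  have h2 := (genRel_Tval (k := k) (p := p) 0 0 1 0).symm_bracket (u - 1) v
  have h3 := genRel_Tval (k := k) (p := p) 0 0 1 0 (u - 1) v
  have h4 : (Tval 1 0 (u - 1) * Tval 0 0 v - Tval 1 0 v * Tval 0 0 (u - 1) : Y k p) =
      Tval 0 0 v * Tval 1 0 (u - 1) - Tval 0 0 (u - 1) * Tval 1 0 v := by
    linear_combination (norm := noncomm_ring) h2
  rw [h3, h4, sub_self, zero_mul, smul_zero, sub_add_cancel, ← Dval_eq] at h
  refine (smul_eq_zero.1 h).resolve_left (mul_ne_zero (fun h0 => hu.1 ?_) fun h0 => hu.2 ?_)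
  · linear_combination h0
  · linear_combination h0

variable {β : Fin p → k} {γ : Fin (2 * p) → k}
variable {V : Type*} [AddCommGroup V] [Module (Y k p) V] [Module k V] [IsScalarTower k (Y k p) V]

lemma smul_smul_comm' (c : k) (y : Y k p) (x : V) : y • c • x = c • y • x := by
  rw [← algebraMap_smul (Y k p) c x, ← algebraMap_smul (Y k p) c (y • x), smul_smul, smul_smul,
    Algebra.commutes]

/-- The action of `Y` on a vector, as a `k`-linear map. -/
def smulVec (w : V) : Y k p →ₗ[k] V where
  toFun y := y • w
  map_add' x y := add_smul x y w
  map_smul' c y := smul_assoc c y w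

lemma eval_shift_node (m : Fin p → ℤ) (i : Fin p) :
    (tuplePoly (shift β m)).eval (-shift β m i) = 0 := by
  rw [eval_tuplePoly_eq_mul_cofactor _ i, neg_add_cancel, zero_mul]

lemma d_node_smul [CharZero k] {m : Fin p → ℤ} {w : V} (hw : w ∈ weightSpace (shift β m) γ V) (i : Fin p) :
    (Tval 1 1 (-shift β m i) : Y k p) • w = 0 := by
  rw [(mem_weightSpace_iff.1 hw).1, eval_shift_node, zero_smul]

/-- As T₂₂(v) w = 0 at the node v, the relation of T₂₂ and T₁₂ reads (u - v) T₂₂(u) T₁₂(v) w = (u -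
v - 1) χ(u) T₁₂(v) w. Cancelling u - v replaces the factor u - v of χ by u - v - 1. At u = v this
needs continuation of polynomial functions. -/
lemma b_node_mem [CharZero k] {m : Fin p → ℤ} {w : V} (hw : w ∈ weightSpace (shift β m) γ V) (i : Fin p) :
    (Tval 0 1 (-shift β m i) : Y k p) • w ∈
      weightSpace (shift β (m + Pi.single i (-1))) γ V := by
  set v := -shift β m i with hv
  rw [mem_weightSpace_iff] at hw ⊢
  refine ⟨fun u => ?_, fun u => ?_⟩
  · have h1 : IsPolyFun (p + 1) fun u => (Tval 1 1 u : Y k p) • (Tval 0 1 v : Y k p) • w :=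
      (isPolyFun_gen p (t k p 1 1)).map (smulVec (k := k) ((Tval 0 1 v : Y k p) • w))
    have h2 : IsPolyFun (p + 1) fun u => (tuplePoly (shift β (m + Pi.single i (-1)))).eval u •
        (Tval 0 1 v : Y k p) • w := isPolyFun_poly_smul (by
      rw [degree_eq_natDegree (tuplePoly_monic _).ne_zero, tuplePoly_natDegree]
      exact_mod_cast Nat.lt_succ_self p) _
    rw [← sub_eq_zero]
    refine (h1.sub h2).eq_zero_of_cofinite {v} (Set.finite_singleton v) (fun u hu => ?_) u
    have h := congrArg (· • w) (genRel_Tval (k := k) (p := p) 1 1 0 1 u v)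
    simp only [smul_assoc, sub_smul, mul_smul, hw.1, smul_smul_comm', hv, eval_shift_node,
      zero_smul, smul_zero] at h
    rw [← hv, eval_tuplePoly_eq_mul_cofactor _ i] at h
    rw [eval_tuplePoly_shift_add]
    have hs : shift β m i = -v := by rw [hv, neg_neg]
    rw [hs] at h ⊢
    have hne : u - v ≠ 0 := sub_ne_zero.2 hu
    refine (smul_eq_zero.1 (?_ : (u - v) • (_ : V) = 0)).resolve_left hne
    push_cast
    generalize (Tval 0 1 v : Y k p) • w = x at h ⊢
    generalize (Tval 1 1 u : Y k p) • x = y at h ⊢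
    linear_combination (norm := module) h
  · rw [smul_smul, commute_Dval_b, mul_smul, hw.2, smul_smul_comm']

lemma c_node_mem [CharZero k] {m : Fin p → ℤ} {w : V} (hw : w ∈ weightSpace (shift β m) γ V) (i : Fin p) :
    (Tval 1 0 (-shift β m i) : Y k p) • w ∈
      weightSpace (shift β (m + Pi.single i 1)) γ V := by
  set v := -shift β m i with hv
  rw [mem_weightSpace_iff] at hw ⊢
  refine ⟨fun u => ?_, fun u => ?_⟩
  · have h1 : IsPolyFun (p + 1) fun u => (Tval 1 1 u : Y k p) • (Tval 1 0 v : Y k p) • w :=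
      (isPolyFun_gen p (t k p 1 1)).map (smulVec (k := k) ((Tval 1 0 v : Y k p) • w))
    have h2 : IsPolyFun (p + 1) fun u => (tuplePoly (shift β (m + Pi.single i 1))).eval u •
        (Tval 1 0 v : Y k p) • w := isPolyFun_poly_smul (by
      rw [degree_eq_natDegree (tuplePoly_monic _).ne_zero, tuplePoly_natDegree]
      exact_mod_cast Nat.lt_succ_self p) _
    rw [← sub_eq_zero]
    refine (h1.sub h2).eq_zero_of_cofinite {v} (Set.finite_singleton v) (fun u hu => ?_) u
    have h := congrArg (· • w) (genRel_Tval (k := k) (p := p) 1 0 1 1 v u)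
    simp only [smul_assoc, sub_smul, mul_smul, hw.1, smul_smul_comm', hv, eval_shift_node,
      zero_smul, smul_zero] at h
    rw [← hv, eval_tuplePoly_eq_mul_cofactor _ i] at h
    rw [eval_tuplePoly_shift_add]
    have hs : shift β m i = -v := by rw [hv, neg_neg]
    rw [hs] at h ⊢
    have hne : u - v ≠ 0 := sub_ne_zero.2 hu
    refine (smul_eq_zero.1 (?_ : (u - v) • (_ : V) = 0)).resolve_left hne
    push_cast
    generalize (Tval 1 0 v : Y k p) • w = x at h ⊢
    generalize (Tval 1 1 u : Y k p) • x = y at h ⊢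
    linear_combination (norm := module) h
  · rw [smul_smul, commute_Dval_c, mul_smul, hw.2, smul_smul_comm']

/-- The right side of the RTT relation ends in values of T₂₂ at nodes, which kill w, and the two
nodes are distinct. -/
lemma cb_comm_node [CharZero k] (hβ : IsGeneric β) {m : Fin p → ℤ} {w : V}
    (hw : w ∈ weightSpace (shift β m) γ V) {i j : Fin p} (hij : i ≠ j) :
    (Tval 1 0 (-shift β m i) : Y k p) • (Tval 0 1 (-shift β m j) : Y k p) • w =
      (Tval 0 1 (-shift β m j) : Y k p) • (Tval 1 0 (-shift β m i) : Y k p) • w := by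
  have h := congrArg (· • w) (genRel_Tval (k := k) (p := p) 1 0 0 1 (-shift β m i) (-shift β m j))
  simp only [smul_assoc, sub_smul, mul_smul, d_node_smul hw, smul_zero, sub_self] at h
  rw [← sub_smul] at h
  exact sub_eq_zero.1 ((smul_eq_zero.1 h).resolve_left
    (sub_ne_zero.2 fun h => hij (shift_injective hβ m h)))

/-- At this argument T₂₂(u-1) kills w, so D(u) = γ(u) reduces to its second term. `bc_node` uses the
other expression of D(u). -/
lemma cb_node [CharZero k] {m : Fin p → ℤ} {w : V} (hw : w ∈ weightSpace (shift β m) γ V) (i : Fin p) :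
    (Tval 1 0 (-shift β m i + 1) : Y k p) • (Tval 0 1 (-shift β m i) : Y k p) • w =
      -(tuplePoly γ).eval (-shift β m i + 1) • w := by
  have h := (mem_weightSpace_iff.1 hw).2 (-shift β m i + 1)
  rw [Dval, add_sub_cancel_right, sub_smul, mul_smul, mul_smul, d_node_smul hw, smul_zero,
    zero_sub] at h
  rw [neg_smul, ← h, neg_neg]

lemma bc_node [CharZero k] {m : Fin p → ℤ} {w : V} (hw : w ∈ weightSpace (shift β m) γ V) (i : Fin p) :
    (Tval 0 1 (-shift β m i - 1) : Y k p) • (Tval 1 0 (-shift β m i) : Y k p) • w =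
      -(tuplePoly γ).eval (-shift β m i) • w := by
  have h := (mem_weightSpace_iff.1 hw).2 (-shift β m i)
  rw [Dval_eq, sub_smul, mul_smul, mul_smul, d_node_smul hw, smul_zero,
    zero_sub] at h
  rw [neg_smul, ← h, neg_neg]

variable (β) in
/-- The product of `n` values of `T₂₁` which raises the `j`-th coordinate of a weight from
`β_j` to `β_j + n`. -/
def raise (j : Fin p) : ℕ → Y k p
  | 0 => 1
  | n + 1 => Tval 1 0 (-(β j + n)) * raise j n

variable (β) in
/-- The product of `n` values of `T₁₂` which lowers the `j`-th coordinate of a weight from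
`β_j` to `β_j - n`. -/
def lower (j : Fin p) : ℕ → Y k p
  | 0 => 1
  | n + 1 => Tval 0 1 (-(β j - n)) * lower j n

variable (β) in
/-- The element which shifts the `j`-th coordinate of a weight from `β_j` to `β_j + n`. -/
def ladder (j : Fin p) : ℤ → Y k p
  | .ofNat n => raise β j n
  | .negSucc n => lower β j (n + 1)

lemma ladder_natCast (j : Fin p) (n : ℕ) : ladder β j n = raise β j n := rfl

lemma ladder_neg_natCast (j : Fin p) (n : ℕ) : ladder β j (-n) = lower β j n := by
  cases n <;> rfl

lemma shift_add_single_self (m : Fin p → ℤ) (j : Fin p) (hm : m j = 0) (c : ℤ) :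
    shift β (m + Pi.single j c) j = β j + c := by
  simp [shift, hm]

lemma raise_mem [CharZero k] {m : Fin p → ℤ} {w : V} (hw : w ∈ weightSpace (shift β m) γ V) {j : Fin p}
    (hm : m j = 0) (n : ℕ) : raise β j n • w ∈ weightSpace (shift β (m + Pi.single j (n : ℤ))) γ V := by
  induction n with
  | zero => simpa [raise] using hw
  | succ n ih =>
    have h := c_node_mem ih j
    rw [shift_add_single_self m j hm, add_assoc, ← Pi.single_add] at h
    rw [raise, mul_smul]
    exact_mod_cast h

lemma lower_mem [CharZero k] {m : Fin p → ℤ} {w : V} (hw : w ∈ weightSpace (shift β m) γ V) {j : Fin p}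
    (hm : m j = 0) (n : ℕ) :
    lower β j n • w ∈ weightSpace (shift β (m + Pi.single j (-n : ℤ))) γ V := by
  induction n with
  | zero => simpa [lower] using hw
  | succ n ih =>
    have h := b_node_mem ih j
    rw [shift_add_single_self m j hm, add_assoc, ← Pi.single_add] at h
    have e : -(n : ℤ) + -1 = -((n + 1 : ℕ) : ℤ) := by push_cast; ring
    rw [e] at h
    rw [lower, mul_smul, sub_eq_add_neg]
    exact_mod_cast h

lemma ladder_mem [CharZero k] {m : Fin p → ℤ} {w : V} (hw : w ∈ weightSpace (shift β m) γ V) {j : Fin p}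
    (hm : m j = 0) (n : ℤ) : ladder β j n • w ∈ weightSpace (shift β (m + Pi.single j n)) γ V := by
  rcases Int.eq_nat_or_neg n with ⟨n, rfl | rfl⟩
  · rw [ladder_natCast]; exact raise_mem hw hm n
  · rw [ladder_neg_natCast]; exact lower_mem hw hm n

/-- Values of T₂₁ commute with each other, and with values of T₁₂ on vectors for which the two
arguments are different nodes. -/
lemma c_smul_ladder [CharZero k] (hβ : IsGeneric β) {m : Fin p → ℤ} {w : V}
    (hw : w ∈ weightSpace (shift β m) γ V) {i j : Fin p} (hij : i ≠ j) (hm : m j = 0) (n : ℤ) :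
    (Tval 1 0 (-shift β m i) : Y k p) • ladder β j n • w =
      ladder β j n • (Tval 1 0 (-shift β m i) : Y k p) • w := by
  rcases Int.eq_nat_or_neg n with ⟨n, rfl | rfl⟩
  · rw [ladder_natCast]
    induction n with
    | zero => simp [raise]
    | succ n ih =>
      rw [raise, mul_smul, smul_smul, commute_Tval_self, mul_smul, ih, mul_smul]
  · rw [ladder_neg_natCast]
    induction n with
    | zero => simp [lower]
    | succ n ih =>
      have h := cb_comm_node hβ (lower_mem hw hm n) hij
      rw [shift_add_single_self m j hm, shift_add_single_of_ne hij] at h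
      push_cast at h
      rw [← sub_eq_add_neg] at h
      rw [lower, mul_smul, h, ih, mul_smul]

lemma b_smul_ladder [CharZero k] (hβ : IsGeneric β) {m : Fin p → ℤ} {w : V}
    (hw : w ∈ weightSpace (shift β m) γ V) {i j : Fin p} (hij : i ≠ j) (hm : m j = 0) (n : ℤ) :
    (Tval 0 1 (-shift β m i) : Y k p) • ladder β j n • w =
      ladder β j n • (Tval 0 1 (-shift β m i) : Y k p) • w := by
  rcases Int.eq_nat_or_neg n with ⟨n, rfl | rfl⟩
  · rw [ladder_natCast]
    induction n with
    | zero => simp [raise]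
    | succ n ih =>
      have h := cb_comm_node hβ (raise_mem hw hm n) hij.symm
      rw [shift_add_single_self m j hm, shift_add_single_of_ne hij] at h
      push_cast at h
      rw [raise, mul_smul, ← h, ih, mul_smul]
  · rw [ladder_neg_natCast]
    induction n with
    | zero => simp [lower]
    | succ n ih =>
      rw [lower, mul_smul, smul_smul, commute_Tval_self, mul_smul, ih, mul_smul]

variable (β γ) in
/-- The matrix elements of the lowering operators. -/
def lowerCoeff (i : Fin p) (n : ℤ) : k :=
  if n ≤ 0 then 1 else -(tuplePoly γ).eval (-(β i + n) + 1)

variable (β γ) in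
/-- The matrix elements of the raising operators. -/
def raiseCoeff (i : Fin p) (n : ℤ) : k :=
  if 0 ≤ n then 1 else -(tuplePoly γ).eval (-(β i + n))

/-- The normalisation gives coefficient 1 to steps away from coordinate 0 and charges the whole
determinant value to the step back. So e_0 generates the module even where γ vanishes, and the
product is what `gt_qdet` requires. -/
lemma lowerCoeff_mul_raiseCoeff (i : Fin p) (n : ℤ) :
    lowerCoeff β γ i (n + 1) * raiseCoeff β γ i n = -(tuplePoly γ).eval (-(β i + n)) := by
  rw [lowerCoeff, raiseCoeff]
  by_cases h : 0 ≤ n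
  · rw [if_neg (by omega), if_pos h, mul_one]
    congr 2
    push_cast
    ring
  · rw [if_pos (by omega), if_neg h, one_mul]

/-- For n ≥ 0 this is one more step of the ladder; for n < 0 it undoes the last lowering, at the
cost computed in `cb_node`. -/
lemma c_smul_ladder_self [CharZero k] {m : Fin p → ℤ} {w : V}
    (hw : w ∈ weightSpace (shift β m) γ V) {j : Fin p} (hm : m j = 0) (n : ℤ) :
    (Tval 1 0 (-(β j + n)) : Y k p) • ladder β j n • w =
      raiseCoeff β γ j n • ladder β j (n + 1) • w := by
  rcases n with n | n
  · rw [raiseCoeff, if_pos (by simp), one_smul]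
    change _ = raise β j (n + 1) • w
    rw [raise, mul_smul]
    simp [ladder]
  · have h := cb_node (lower_mem hw hm n) j
    rw [shift_add_single_self m j hm] at h
    have e : Int.negSucc n + 1 = -(n : ℤ) := by omega
    have e2 : -(β j + ((-n : ℤ) : k)) + 1 = -(β j + ((Int.negSucc n : ℤ) : k)) := by
      rw [Int.negSucc_eq]; push_cast; ring
    rw [raiseCoeff, if_neg (by omega), e, ladder_neg_natCast, ← e2, ← h]
    change _ • lower β j (n + 1) • w = _
    rw [lower, mul_smul]
    simp [sub_eq_add_neg]

lemma b_smul_ladder_self [CharZero k] {m : Fin p → ℤ} {w : V}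
    (hw : w ∈ weightSpace (shift β m) γ V) {j : Fin p} (hm : m j = 0) (n : ℤ) :
    (Tval 0 1 (-(β j + n)) : Y k p) • ladder β j n • w =
      lowerCoeff β γ j n • ladder β j (n + -1) • w := by
  by_cases hn : n ≤ 0
  · obtain ⟨n, rfl⟩ : ∃ q : ℕ, n = -(q : ℤ) := ⟨n.natAbs, by omega⟩
    have e : -(n : ℤ) + -1 = -((n + 1 : ℕ) : ℤ) := by push_cast; ring
    rw [lowerCoeff, if_pos hn, one_smul, e, ladder_neg_natCast, ladder_neg_natCast, lower, mul_smul]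
    simp [sub_eq_add_neg]
  · obtain ⟨n, rfl⟩ : ∃ q : ℕ, n = (q : ℤ) + 1 := ⟨(n - 1).toNat, by omega⟩
    have h := bc_node (raise_mem hw hm n) j
    rw [shift_add_single_self m j hm] at h
    have e2 : -(β j + ((n : ℤ) : k)) = -(β j + (((n : ℤ) + 1 : ℤ) : k)) + 1 := by
      push_cast; ring
    rw [lowerCoeff, if_neg hn, ← e2, add_neg_cancel_right, ladder_natCast, ← h]
    change _ • raise β j (n + 1) • w = _
    rw [raise, mul_smul]
    have e3 : -(β j + (((n : ℤ) + 1 : ℤ) : k)) = -(β j + ((n : ℤ) : k)) - 1 := by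
      push_cast; ring
    rw [e3, Int.cast_natCast]

/-- A family of vectors on which the ladder operators act by the matrix elements of the
Gelfand–Tsetlin module. -/
lemma exists_gt_family [CharZero k] (hβ : IsGeneric β) {η : V} (hη : η ∈ weightSpace β γ V) :
    ∃ e : (Fin p → ℤ) → V, e 0 = η ∧ (∀ m, e m ∈ weightSpace (shift β m) γ V) ∧
      ∀ i m, (Tval 1 0 (-shift β m i) : Y k p) • e m =
          raiseCoeff β γ i (m i) • e (m + Pi.single i 1) ∧
        (Tval 0 1 (-shift β m i) : Y k p) • e m =
          lowerCoeff β γ i (m i) • e (m + Pi.single i (-1)) := by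
  -- The family is built one coordinate at a time: at stage S it moves only the coordinates in S and
  -- ignores the others.
  suffices h : ∀ S : Finset (Fin p), ∃ e : (Fin p → ℤ) → V, e 0 = η ∧
      (∀ m, e m ∈ weightSpace (shift β fun i => if i ∈ S then m i else 0) γ V) ∧
      (∀ m m', (∀ i ∈ S, m i = m' i) → e m = e m') ∧
      ∀ i ∈ S, ∀ m, (Tval 1 0 (-shift β m i) : Y k p) • e m =
          raiseCoeff β γ i (m i) • e (m + Pi.single i 1) ∧
        (Tval 0 1 (-shift β m i) : Y k p) • e m =
          lowerCoeff β γ i (m i) • e (m + Pi.single i (-1)) by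
    obtain ⟨e, h0, h1, -, h2⟩ := h Finset.univ
    exact ⟨e, h0, fun m => by simpa using h1 m, fun i m => h2 i (Finset.mem_univ i) m⟩
  intro S
  induction S using Finset.induction_on with
  | empty =>
    refine ⟨fun _ => η, rfl, fun m => ?_, fun _ _ _ => rfl, by simp⟩
    simpa [← Pi.zero_def, shift_zero] using hη
  | insert j S hj ih =>
    obtain ⟨e, h0, h1, h2, h3⟩ := ih
    have hres : ∀ m : Fin p → ℤ, (fun i => if i ∈ S then m i else 0) j = 0 := fun m => if_neg hj
    have hsh : ∀ m : Fin p → ℤ, ∀ i ∈ S,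
        shift β (fun i => if i ∈ S then m i else 0) i = shift β m i := fun m i hi => by
      simp [shift, hi]
    -- The ladder in the new coordinate j is applied last. Operators at nodes of the coordinates in
    -- S commute past it, so the formulas already obtained persist.
    refine ⟨fun m => ladder β j (m j) • e m, ?_, fun m => ?_, fun m m' h => ?_, fun i hi m => ?_⟩
    · change raise β j 0 • e 0 = η
      rw [raise, one_smul, h0]
    · convert ladder_mem (h1 m) (hres m) (m j) using 2
      funext i
      rcases eq_or_ne i j with rfl | hij
      · simp [shift, hj]
      · simp [shift, hij]
    · dsimp only
      rw [h j (Finset.mem_insert_self j S), h2 m m' fun i hi => h i (Finset.mem_insert_of_mem hi)]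
    · rcases eq_or_ne i j with rfl | hij
      · have h4 : ∀ c : ℤ, e (m + Pi.single i c) = e m := fun c => h2 _ _ fun i' hi' => by
          have : i' ≠ i := fun h => hj (h ▸ hi')
          simp [this]
        have h5 := c_smul_ladder_self (h1 m) (hres m) (m i)
        have h6 := b_smul_ladder_self (h1 m) (hres m) (m i)
        simp only [h4, Pi.add_apply, Pi.single_eq_same]
        exact ⟨h5, h6⟩
      · have hi : i ∈ S := (Finset.mem_insert.1 hi).resolve_left hij
        have h5 := c_smul_ladder hβ (h1 m) hij (hres m) (m j)
        have h6 := b_smul_ladder hβ (h1 m) hij (hres m) (m j)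
        rw [hsh m i hi] at h5 h6
        simp only [h5, h6, (h3 i hi m).1, (h3 i hi m).2, smul_smul_comm', Pi.add_apply,
          Pi.single_eq_of_ne hij.symm, add_zero, and_self]

end Ladder

/-! ### The Yangian action on the Gelfand–Tsetlin space and its universal property -/

section GTModule

variable {k : Type*} [Field k] {p : ℕ} {β : Fin p → k}

/-- The Gelfand–Tsetlin module: the universal module with a vector of weight `(β, γ)`, with the
vectors of weight `β + m` as a basis. -/
@[nolint unusedArguments]
def GT (_ : IsGeneric β) (_ : 0 < p) (_ : Fin (2 * p) → k) : Type _ := GTSpace k p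

variable (hβ : IsGeneric β) (hp : 0 < p) (γ : Fin (2 * p) → k)

instance : AddCommGroup (GT hβ hp γ) := inferInstanceAs (AddCommGroup (GTSpace k p))

instance : Module k (GT hβ hp γ) := inferInstanceAs (Module k (GTSpace k p))

/-- The basis of the Gelfand–Tsetlin module. -/
def gtVec (m : Fin p → ℤ) : GT hβ hp γ := gtBasis k m

variable {γ}

lemma gt_eq_sum (w : GT hβ hp γ) :
    ∃ (S : Finset (Fin p → ℤ)) (c : (Fin p → ℤ) → k), w = ∑ m ∈ S, c m • gtVec hβ hp γ m := by
  let w' : GTSpace k p := w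
  refine ⟨w'.support, w', ?_⟩
  have h := Finsupp.sum_single w'
  refine h.symm.trans (Finset.sum_congr rfl fun m _ => ?_)
  exact (Finsupp.smul_single_one m _).symm

lemma gtVec_ne_zero (m : Fin p → ℤ) : gtVec hβ hp γ m ≠ 0 := fun h =>
  one_ne_zero (Finsupp.single_eq_zero.1 (h : (Finsupp.single m 1 : GTSpace k p) = 0))

variable [CharZero k]

variable (γ) in
/-- The action of the Yangian on the Gelfand–Tsetlin space. -/
def gtRep :
    Y k p →ₐ[k] Module.End k (GTSpace k p) :=
  RingQuot.liftAlgHom k ⟨FreeAlgebra.lift k fun g : Gen p =>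
    gtT β (lowerCoeff β γ) (raiseCoeff β γ) g.1 g.2.1 (g.2.2 + 1), by
    have key : ∀ i j r, FreeAlgebra.lift k (fun g : Gen p =>
        gtT β (lowerCoeff β γ) (raiseCoeff β γ) g.1 g.2.1 (g.2.2 + 1)) (freeT k p i j r) =
        gtT β (lowerCoeff β γ) (raiseCoeff β γ) i j r := by
      intro i j r
      rw [freeT]
      split_ifs with h1 h2 h3
      · rw [h1, gtT_zero, if_pos h2, map_one]
      · rw [h1, gtT_zero, if_neg h2, map_zero]
      · rw [FreeAlgebra.lift_ι_apply]
        congr 1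
        exact Nat.sub_add_cancel (Nat.pos_of_ne_zero h1)
      · rw [map_zero, gtT_of_lt]
        omega
    rintro x y ⟨i, j, l, m, r, s, hr, hs⟩
    have h := coeffRel_gtT hβ hp γ lowerCoeff_mul_raiseCoeff i j l m r s
    simp only [map_sub, map_mul, map_sum, key]
    exact h⟩

variable (γ) in
lemma gtRep_t (i j : Fin 2) (r : ℕ) :
    gtRep hβ hp γ (t k p i j r) = gtT β (lowerCoeff β γ) (raiseCoeff β γ) i j r := by
  rw [t, gtRep, RingQuot.liftAlgHom_mkAlgHom_apply, freeT]
  split_ifs with h1 h2 h3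
  · rw [h1, gtT_zero, if_pos h2, map_one]
  · rw [h1, gtT_zero, if_neg h2, map_zero]
  · rw [FreeAlgebra.lift_ι_apply]
    congr 1
    exact Nat.sub_add_cancel (Nat.pos_of_ne_zero h1)
  · rw [map_zero, gtT_of_lt]
    omega

variable (γ) in
lemma gtRep_Tval (i j : Fin 2) (u : k) :
    gtRep hβ hp γ (Tval i j u) = gen p (gtT β (lowerCoeff β γ) (raiseCoeff β γ) i j) u := by
  simp only [gen, map_sum, map_smul, gtRep_t]

instance gtModule : Module (Y k p) (GT hβ hp γ) :=
  Module.compHom (GTSpace k p) (gtRep hβ hp γ).toRingHom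

lemma gt_smul_def (y : Y k p) (w : GT hβ hp γ) :
    y • w = (gtRep hβ hp γ y (w : GTSpace k p) : GTSpace k p) := rfl

instance : IsScalarTower k (Y k p) (GT hβ hp γ) where
  smul_assoc c y w := by
    rw [gt_smul_def, map_smul]
    rfl

lemma Tval_smul_gt (i j : Fin 2) (u : k) (w : GT hβ hp γ) : (Tval i j u : Y k p) • w =
    (gen p (gtT β (lowerCoeff β γ) (raiseCoeff β γ) i j) u (w : GTSpace k p) : GTSpace k p) := by
  rw [gt_smul_def, gtRep_Tval]

lemma Dval_smul_gt (u : k) (w : GT hβ hp γ) :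
    (Dval u : Y k p) • w = (tuplePoly γ).eval u • w := by
  have h := gt_qdet (lowerCoeff β γ) (raiseCoeff β γ) hβ hp γ lowerCoeff_mul_raiseCoeff u
  have h' := congrArg (fun f : Module.End k (GTSpace k p) => f w) h
  rw [sub_smul, mul_smul, mul_smul, Tval_smul_gt, Tval_smul_gt, Tval_smul_gt, Tval_smul_gt]
  exact h'

lemma gt_hasCentralCharacter : HasCentralCharacter γ (GT hβ hp γ) :=
  hasCentralCharacter_iff.2 fun w u => Dval_smul_gt hβ hp u w

lemma gtVec_mem (m : Fin p → ℤ) :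
    gtVec hβ hp γ m ∈ weightSpace (shift β m) γ (GT hβ hp γ) :=
  mem_weightSpace_iff.2 ⟨fun u => (Tval_smul_gt hβ hp 1 1 u _).trans (gen_gtD_apply β u m),
    fun u => Dval_smul_gt hβ hp u _⟩

lemma b_smul_gtVec (m : Fin p → ℤ) (i : Fin p) :
    (Tval 0 1 (-shift β m i) : Y k p) • gtVec hβ hp γ m =
      lowerCoeff β γ i (m i) • gtVec hβ hp γ (m + Pi.single i (-1)) :=
  (Tval_smul_gt hβ hp 0 1 _ _).trans (gen_gtB_node _ hβ (-1) m i)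

lemma c_smul_gtVec (m : Fin p → ℤ) (i : Fin p) :
    (Tval 1 0 (-shift β m i) : Y k p) • gtVec hβ hp γ m =
      raiseCoeff β γ i (m i) • gtVec hβ hp γ (m + Pi.single i 1) :=
  (Tval_smul_gt hβ hp 1 0 _ _).trans (gen_gtB_node _ hβ 1 m i)

/-- All basis vectors are obtained from the basis vector of weight `β`. -/
lemma exists_smul_gtVec_zero (m : Fin p → ℤ) :
    ∃ y : Y k p, y • gtVec hβ hp γ 0 = gtVec hβ hp γ m := by
  -- Starting from coordinate 0, every step leads away from it and has coefficient 1, so no division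
  -- by values of γ occurs.
  have up : ∀ (m : Fin p → ℤ) (i : Fin p), m i = 0 → ∀ n : ℕ, ∃ y : Y k p,
      y • gtVec hβ hp γ m = gtVec hβ hp γ (m + Pi.single i (n : ℤ)) := by
    intro m i hm n
    induction n with
    | zero => exact ⟨1, by simp⟩
    | succ n ih =>
      obtain ⟨y, hy⟩ := ih
      refine ⟨Tval 1 0 (-shift β (m + Pi.single i (n : ℤ)) i) * y, ?_⟩
      rw [mul_smul, hy, c_smul_gtVec, raiseCoeff, if_pos (by simp [hm]), one_smul, add_assoc,
        ← Pi.single_add]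
      rfl
  have down : ∀ (m : Fin p → ℤ) (i : Fin p), m i = 0 → ∀ n : ℕ, ∃ y : Y k p,
      y • gtVec hβ hp γ m = gtVec hβ hp γ (m + Pi.single i (-n : ℤ)) := by
    intro m i hm n
    induction n with
    | zero => exact ⟨1, by simp⟩
    | succ n ih =>
      obtain ⟨y, hy⟩ := ih
      refine ⟨Tval 0 1 (-shift β (m + Pi.single i (-n : ℤ)) i) * y, ?_⟩
      rw [mul_smul, hy, b_smul_gtVec, lowerCoeff, if_pos (by simp [hm]), one_smul, add_assoc,
        ← Pi.single_add]
      congr 3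
      push_cast
      ring
  have both : ∀ (m : Fin p → ℤ) (i : Fin p), m i = 0 → ∀ n : ℤ, ∃ y : Y k p,
      y • gtVec hβ hp γ m = gtVec hβ hp γ (m + Pi.single i n) := by
    intro m i hm n
    rcases Int.eq_nat_or_neg n with ⟨n, rfl | rfl⟩
    exacts [up m i hm n, down m i hm n]
  suffices h : ∀ S : Finset (Fin p), ∃ y : Y k p,
      y • gtVec hβ hp γ 0 = gtVec hβ hp γ fun i => if i ∈ S then m i else 0 by
    simpa using h Finset.univ
  intro S
  induction S using Finset.induction_on with
  | empty => exact ⟨1, by rw [one_smul]; congr 1⟩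
  | insert j S hj ih =>
    obtain ⟨y, hy⟩ := ih
    obtain ⟨z, hz⟩ := both (fun i => if i ∈ S then m i else 0) j (if_neg hj) (m j)
    refine ⟨z * y, ?_⟩
    rw [mul_smul, hy, hz]
    congr 1
    funext i
    rcases eq_or_ne i j with rfl | hij
    · simp [hj]
    · simp [hij]

lemma span_gtVec_zero : Submodule.span (Y k p) {gtVec hβ hp γ 0} = ⊤ := by
  rw [eq_top_iff]
  rintro w -
  obtain ⟨S, c, rfl⟩ := gt_eq_sum hβ hp w
  refine Submodule.sum_mem _ fun m _ => ?_
  obtain ⟨y, hy⟩ := exists_smul_gtVec_zero hβ hp (γ := γ) m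
  rw [← hy, ← smul_assoc]
  exact Submodule.smul_mem _ _ (Submodule.mem_span_singleton_self _)

section Universal

variable {V : Type*} [AddCommGroup V] [Module (Y k p) V] [Module k V] [IsScalarTower k (Y k p) V]

lemma coeff_smul_eq_of_Tval {i j : Fin 2} {f : GT hβ hp γ →ₗ[k] V} {w : GT hβ hp γ}
    (h : ∀ u, f ((Tval i j u : Y k p) • w) = (Tval i j u : Y k p) • f w) (r : ℕ) :
    f (t k p i j r • w) = t k p i j r • f w := by
  by_cases hr : p < r
  · rw [t_of_lt i j hr, zero_smul, zero_smul, map_zero]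
  rw [← sub_eq_zero]
  refine coeff_eq_zero_of_sum_pow_rev (k := k) (n := p)
    (c := fun r => f (t k p i j r • w) - t k p i j r • f w) (fun u => ?_) (by omega)
  rw [← sub_eq_zero.2 (h u), Tval, gen]
  simp only [Finset.sum_smul, map_sum, smul_assoc, map_smul, smul_sub, Finset.sum_sub_distrib]

/-- The universal property of the Gelfand–Tsetlin module. -/
lemma exists_gt_hom {η : V} (hη : η ∈ weightSpace β γ V) :
    ∃ f : GT hβ hp γ →ₗ[Y k p] V, f (gtVec hβ hp γ 0) = η := by
  obtain ⟨e, h0, h1, h2⟩ := exists_gt_family hβ hη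
  let f : GT hβ hp γ →ₗ[k] V := Finsupp.linearCombination k e
  have hf : ∀ m, f (gtVec hβ hp γ m) = e m := fun m => by
    refine (Finsupp.linearCombination_single k 1 m).trans (one_smul _ _)
  have hlin : ∀ y : Y k p, (∀ m, f (y • gtVec hβ hp γ m) = y • e m) → ∀ w, f (y • w) = y • f w := by
    intro y hy w
    obtain ⟨S, c, rfl⟩ := gt_eq_sum hβ hp w
    simp only [Finset.smul_sum, map_sum, smul_smul_comm', map_smul, hy, hf]
  -- T₁₂(u) has degree less than p in u, so agreement at the p nodes of weight β + m suffices.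
  have hb : ∀ u m, f ((Tval 0 1 u : Y k p) • gtVec hβ hp γ m) = (Tval 0 1 u : Y k p) • e m := by
    intro u m
    have hP := isPolyFun_gen_of_zero (k := k) (p := p) (t := t k p 0 1) (t_zero 0 1)
    have := ((hP.map (smulVec (gtVec hβ hp γ m))).map f).sub (hP.map (smulVec (e m)))
    refine sub_eq_zero.1 (this.eq_zero (shift_injective hβ m) (fun i => sub_eq_zero.2 ?_) u)
    change f ((Tval 0 1 (-shift β m i) : Y k p) • gtVec hβ hp γ m) =
      (Tval 0 1 (-shift β m i) : Y k p) • e m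
    rw [b_smul_gtVec, map_smul, hf, (h2 i m).2]
  have hc : ∀ u m, f ((Tval 1 0 u : Y k p) • gtVec hβ hp γ m) = (Tval 1 0 u : Y k p) • e m := by
    intro u m
    have hP := isPolyFun_gen_of_zero (k := k) (p := p) (t := t k p 1 0) (t_zero 1 0)
    have := ((hP.map (smulVec (gtVec hβ hp γ m))).map f).sub (hP.map (smulVec (e m)))
    refine sub_eq_zero.1 (this.eq_zero (shift_injective hβ m) (fun i => sub_eq_zero.2 ?_) u)
    change f ((Tval 1 0 (-shift β m i) : Y k p) • gtVec hβ hp γ m) =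
      (Tval 1 0 (-shift β m i) : Y k p) • e m
    rw [c_smul_gtVec, map_smul, hf, (h2 i m).1]
  have hd : ∀ u m, f ((Tval 1 1 u : Y k p) • gtVec hβ hp γ m) = (Tval 1 1 u : Y k p) • e m := by
    intro u m
    rw [(mem_weightSpace_iff.1 (gtVec_mem hβ hp m)).1, (mem_weightSpace_iff.1 (h1 m)).1, map_smul,
      hf]
  -- The elements with which f commutes form a subalgebra, so generators are enough; T₁₁ needs no
  -- separate check.
  let S : Subalgebra k (Y k p) :=
    { carrier := {y | ∀ w, f (y • w) = y • f w}
      mul_mem' := fun {x y} hx hy w => by rw [mul_smul, hx, hy, mul_smul]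
      add_mem' := fun {x y} hx hy w => by rw [add_smul, map_add, hx, hy, add_smul]
      algebraMap_mem' := fun c w => by rw [algebraMap_smul, algebraMap_smul, map_smul] }
  have hS : S = ⊤ := subalgebra_eq_top S
    (fun r w => coeff_smul_eq_of_Tval hβ hp (fun u => hlin _ (hb u) w) r)
    (fun r w => coeff_smul_eq_of_Tval hβ hp (fun u => hlin _ (hc u) w) r)
    (fun r w => coeff_smul_eq_of_Tval hβ hp (fun u => hlin _ (hd u) w) r)
  refine ⟨{ f with map_smul' := fun y w => ?_ }, (hf 0).trans h0⟩
  have : y ∈ S := hS ▸ Algebra.mem_top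
  exact this w

end Universal

end GTModule

/-! ### Points of the maximal spectrum -/

/-- If `a` maps a vector killed by `m` to a vector with annihilator `n`, then `(m, n) ∈ X_a`. -/
lemma linked_of_smul {k U : Type*} [Field k] [Ring U] [Algebra k U] (Γ : Subalgebra k U)
    {V : Type*} [AddCommGroup V] [Module U V] {a : U} {m n : Ideal Γ} {x y : V} (ha : a • x = y)
    (hm : ∀ z ∈ m, (z : U) • x = 0) (hx : ∀ z : Γ, ∃ c : Γ, a • (z : U) • x = (c : U) • y)
    (hn : ∀ z : Γ, z ∈ n ↔ (z : U) • y = 0) : Linked Γ a m n := by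
  let φ : U →ₗ[Γ] V := (LinearMap.toSpanSingleton U V x).restrictScalars Γ
  have hφ : ∀ u, φ u = u • x := fun u => rfl
  let θ : Γ →ₗ[Γ] V := LinearMap.toSpanSingleton Γ V y
  have hθ : LinearMap.ker θ = n := by
    ext z
    rw [hn]
    exact Iff.rfl
  let ψ := φ.domRestrict (bimod Γ a)
  have hψ : LinearMap.ker ψ = (bimod Γ a ⊓ LinearMap.ker φ).submoduleOf (bimod Γ a) := by
    ext x
    simp [ψ, Submodule.submoduleOf]
  have hrange : LinearMap.range ψ = LinearMap.range θ := by
    rw [LinearMap.range_domRestrict, bimod, Submodule.map_span, LinearMap.range_toSpanSingleton]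
    apply le_antisymm
    · rw [Submodule.span_le]
      rintro _ ⟨_, ⟨z, rfl⟩, rfl⟩
      obtain ⟨c, hc⟩ := hx z
      rw [hφ, mul_smul, hc]
      exact Submodule.smul_mem _ c (Submodule.mem_span_singleton_self y)
    · rw [Submodule.span_singleton_le_iff_mem]
      refine Submodule.subset_span ⟨a, ⟨1, by simp⟩, ?_⟩
      rw [hφ, ha]
  -- The map u ↦ u x sends Γ a Γ onto Γ y, which is Γ / n, so the subquotient is Γ a Γ modulo the
  -- kernel; the kernel contains Γ a m because m kills x.
  refine ⟨bimod Γ a ⊓ LinearMap.ker φ, bimod Γ a, ?_, inf_le_left, le_rfl,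
    ⟨(Submodule.quotEquivOfEq _ _ hψ.symm).trans (ψ.quotKerEquivRange.trans
      ((LinearEquiv.ofEq _ _ hrange).trans (θ.quotKerEquivRange.symm.trans
        (Submodule.quotEquivOfEq _ _ hθ))))⟩⟩
  rw [bimodIdeal, Submodule.span_le]
  rintro _ ⟨z, hz, rfl⟩
  refine ⟨Submodule.subset_span ⟨z, rfl⟩, ?_⟩
  change φ _ = 0
  rw [hφ, mul_smul, hm z hz, smul_zero]

section Points

variable {k : Type*} [Field k] {p : ℕ}

lemma coeff_T_one_one {r : ℕ} (hr : r ∈ Finset.Icc 1 p) : (T k p 1 1).coeff (p - r) = t k p 1 1 r := by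
  obtain ⟨h1, h2⟩ := Finset.mem_Icc.1 hr
  rw [T, if_pos rfl, coeff_add, coeff_X_pow, if_neg (by omega), zero_add, finsetSum_coeff,
    Finset.sum_eq_single r]
  · rw [coeff_C_mul, coeff_X_pow, if_pos rfl, mul_one]
  · intro s hs hsr
    have hs := Finset.mem_Icc.1 hs
    rw [coeff_C_mul, coeff_X_pow, if_neg (by omega), mul_zero]
  · exact fun h => (h hr).elim

lemma t_mem_Gam (r : ℕ) : t k p 1 1 r ∈ Gam k p := by
  rcases Nat.eq_zero_or_pos r with rfl | hr
  · rw [t_zero, if_pos rfl]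
    exact one_mem _
  by_cases hrp : p < r
  · rw [t_of_lt 1 1 hrp]
    exact zero_mem _
  · exact Algebra.subset_adjoin (Or.inr ⟨r, Finset.mem_Icc.2 ⟨hr, by omega⟩, rfl⟩)

lemma Tval_mem_Gam (u : k) : (Tval 1 1 u : Y k p) ∈ Gam k p :=
  Subalgebra.sum_mem _ fun r _ => Subalgebra.smul_mem _ (t_mem_Gam r) _

variable (α : Fin p → k) (γ : Fin (2 * p) → k)

/-- Modulo the left ideal of a point, all elements of `Γ` are scalars. -/
lemma exists_eq_add_mem_pointIdeal (z : Gam k p) :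
    ∃ c : k, ∃ w ∈ pointIdeal α γ, z = algebraMap k (Gam k p) c + w := by
  obtain ⟨z, hz⟩ := z
  induction hz using Algebra.adjoin_induction with
  | mem x hx =>
    have hx' : x ∈ Gam k p := Algebra.subset_adjoin hx
    have key : ∀ c : k, x - algebraMap k (Y k p) c ∈ weightRelators α γ →
        ∃ c : k, ∃ w ∈ pointIdeal α γ, (⟨x, hx'⟩ : Gam k p) = algebraMap k (Gam k p) c + w := by
      intro c hc
      refine ⟨c, ⟨x - algebraMap k (Y k p) c, Subalgebra.sub_mem _ hx' (Subalgebra.algebraMap_mem _ c)⟩,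
        Ideal.subset_span hc, Subtype.ext ?_⟩
      exact (add_sub_cancel (algebraMap k (Y k p) c) x).symm
    rcases hx with ⟨r, rfl⟩ | ⟨r, hr, rfl⟩
    · exact key _ ⟨r, Or.inr rfl⟩
    · exact key ((tuplePoly α).coeff (p - r)) ⟨p - r, Or.inl (by rw [coeff_T_one_one hr])⟩
  | algebraMap c => exact ⟨c, 0, zero_mem _, (add_zero (algebraMap k (Gam k p) c)).symm⟩
  | add x y hx hy ihx ihy =>
    obtain ⟨c, w, hw, hc⟩ := ihx
    obtain ⟨d, w', hw', hd⟩ := ihy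
    refine ⟨c + d, w + w', add_mem hw hw', ?_⟩
    have : (⟨x + y, add_mem hx hy⟩ : Gam k p) = ⟨x, hx⟩ + ⟨y, hy⟩ := rfl
    rw [this, hc, hd, map_add, add_add_add_comm]
  | mul x y hx hy ihx ihy =>
    obtain ⟨c, w, hw, hc⟩ := ihx
    obtain ⟨d, w', hw', hd⟩ := ihy
    refine ⟨c * d, algebraMap k _ d * w + (⟨x, hx⟩ : Gam k p) * w',
      add_mem ((pointIdeal α γ).mul_mem_left _ hw) ((pointIdeal α γ).mul_mem_left _ hw'), ?_⟩
    have : (⟨x * y, mul_mem hx hy⟩ : Gam k p) = ⟨x, hx⟩ * ⟨y, hy⟩ := rfl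
    rw [this, hd, mul_add, ← add_assoc]
    congr 1
    rw [hc, add_mul, map_mul, Algebra.commutes d w]

variable {α γ}
variable {V : Type*} [AddCommGroup V] [Module (Y k p) V] [Module k V] [IsScalarTower k (Y k p) V]

lemma smul_eq_zero_of_mem_pointIdeal {x : V} (hx : x ∈ weightSpace α γ V) {z : Gam k p}
    (hz : z ∈ pointIdeal α γ) : (z : Y k p) • x = 0 := by
  induction hz using Submodule.span_induction with
  | mem z hz =>
    obtain ⟨r, hr | hr⟩ := hz
    · rw [hr, sub_smul, algebraMap_smul, (hx r).1, sub_self]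
    · rw [hr, sub_smul, algebraMap_smul, (hx r).2, sub_self]
  | zero => simp
  | add y z _ _ hy hz =>
    have : ((y + z : Gam k p) : Y k p) = y + z := rfl
    rw [this, add_smul, hy, hz, add_zero]
  | smul a y _ hy =>
    have : ((a • y : Gam k p) : Y k p) = a * y := rfl
    rw [this, mul_smul, hy, smul_zero]

lemma add_smul_of_mem_pointIdeal {x : V} (hx : x ∈ weightSpace α γ V) {w : Gam k p} (c : k)
    (hw : w ∈ pointIdeal α γ) : ((algebraMap k (Gam k p) c + w : Gam k p) : Y k p) • x = c • x := by
  have e : ((algebraMap k (Gam k p) c + w : Gam k p) : Y k p) = algebraMap k (Y k p) c + w := rfl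
  rw [e, add_smul, algebraMap_smul, smul_eq_zero_of_mem_pointIdeal hx hw, add_zero]

/-- Γ is spanned by the scalars and the point ideal, and a nonzero weight vector detects the scalar
part. The existence of such a vector is also what makes the ideal proper in `pointIdeal_isMaximal`.
-/
lemma mem_pointIdeal_iff {x : V} (hx : x ∈ weightSpace α γ V) (hx0 : x ≠ 0) {z : Gam k p} :
    z ∈ pointIdeal α γ ↔ (z : Y k p) • x = 0 := by
  refine ⟨smul_eq_zero_of_mem_pointIdeal hx, fun h => ?_⟩
  obtain ⟨c, w, hw, rfl⟩ := exists_eq_add_mem_pointIdeal α γ z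
  rw [add_smul_of_mem_pointIdeal hx c hw] at h
  rwa [(smul_eq_zero.1 h).resolve_right hx0, map_zero, zero_add]

lemma pointIdeal_isMaximal {x : V} (hx : x ∈ weightSpace α γ V) (hx0 : x ≠ 0) :
    (pointIdeal α γ).IsMaximal := by
  refine ⟨⟨fun h => hx0 ?_, fun J hJ => ?_⟩⟩
  · have h1 : (1 : Gam k p) ∈ pointIdeal α γ := h ▸ Submodule.mem_top
    have := smul_eq_zero_of_mem_pointIdeal hx h1
    rwa [OneMemClass.coe_one, one_smul] at this
  · obtain ⟨hle, hnot⟩ := SetLike.lt_iff_le_and_exists.1 hJ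
    obtain ⟨z, hz, hz'⟩ := hnot
    obtain ⟨c, w, hw, rfl⟩ := exists_eq_add_mem_pointIdeal α γ z
    have hc0 : c ≠ 0 := fun h => hz' (by rwa [h, map_zero, zero_add])
    have h0 : w + algebraMap k (Gam k p) (-1) * w = 0 := by
      nth_rewrite 1 [← one_mul w]
      rw [← map_one (algebraMap k (Gam k p)), ← add_mul, ← map_add, add_neg_cancel, map_zero,
        zero_mul]
    have h1 := J.add_mem hz (J.mul_mem_left (algebraMap k (Gam k p) (-1)) (hle hw))
    rw [add_assoc, h0, add_zero] at h1
    have h2 := J.mul_mem_left (algebraMap k _ c⁻¹) h1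
    rw [← map_mul, inv_mul_cancel₀ hc0, map_one] at h2
    exact (Ideal.eq_top_iff_one J).2 h2

end Points

/-! ### Separation and linkage of the weights β + m -/

section GTModule

variable {k : Type*} [Field k] [CharZero k] {p : ℕ} {β : Fin p → k}

/-- The witness is the root at a coordinate where m and m' differ. Were it a root of the other
polynomial, either m_i = m'_i or two of the β would differ by an integer. -/
lemma exists_eval_ne (hβ : IsGeneric β) {m m' : Fin p → ℤ} (h : m ≠ m') :
    ∃ u : k, (tuplePoly (shift β m)).eval u = 0 ∧ (tuplePoly (shift β m')).eval u ≠ 0 := by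
  obtain ⟨i, hi⟩ := Function.ne_iff.1 h
  refine ⟨-shift β m i, eval_shift_node m i, fun h0 => ?_⟩
  rw [tuplePoly_eval, Finset.prod_eq_zero_iff] at h0
  obtain ⟨j, -, hj⟩ := h0
  simp only [shift] at hj
  rcases eq_or_ne j i with rfl | hij
  · refine hi ?_
    have : ((m j : ℤ) : k) = m' j := by linear_combination -hj
    exact_mod_cast this
  · refine hβ j i hij (m i - m' j) ?_
    push_cast
    linear_combination hj

variable (hβ : IsGeneric β) (hp : 0 < p) {γ : Fin (2 * p) → k}

/-- Elements of `Γ` separate the basis vectors of the Gelfand–Tsetlin module. -/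
lemma exists_separating (S : Finset (Fin p → ℤ)) (m₀ : Fin p → ℤ) : ∃ g : Gam k p,
    (g : Y k p) • gtVec hβ hp γ m₀ = gtVec hβ hp γ m₀ ∧
      ∀ m ∈ S, m ≠ m₀ → (g : Y k p) • gtVec hβ hp γ m = 0 := by
  classical
  induction S using Finset.induction_on with
  | empty => exact ⟨1, one_smul _ _, by simp⟩
  | insert m₁ S _ ih =>
    obtain ⟨g, hg, hg'⟩ := ih
    by_cases h : m₁ = m₀
    · refine ⟨g, hg, fun m hm hm0 => ?_⟩
      rcases Finset.mem_insert.1 hm with rfl | hm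
      · exact (hm0 h).elim
      · exact hg' m hm hm0
    obtain ⟨u, hu, hu'⟩ := exists_eval_ne hβ h
    have hw := fun m => (mem_weightSpace_iff.1 (gtVec_mem hβ hp (γ := γ) m)).1 u
    -- T₂₂(u) kills the new vector and multiplies the one to be kept by a nonzero scalar, which is
    -- divided out.
    refine ⟨((tuplePoly (shift β m₀)).eval u)⁻¹ • (g * ⟨Tval 1 1 u, Tval_mem_Gam u⟩), ?_,
      fun m hm hm0 => ?_⟩
    · change (_ • (_ * _)) • _ = _
      rw [smul_assoc, mul_smul, hw, smul_smul_comm', hg, smul_smul, inv_mul_cancel₀ hu', one_smul]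
    · change (_ • (_ * _)) • _ = _
      rw [smul_assoc, mul_smul, hw, smul_smul_comm']
      rcases Finset.mem_insert.1 hm with rfl | hm
      · rw [hu, zero_smul, smul_zero]
      · rw [hg' m hm hm0, smul_zero, smul_zero]

lemma gt_pointIdeal_isMaximal (hβ : IsGeneric β) (hp : 0 < p) (m : Fin p → ℤ) : (pointIdeal (shift β m) γ).IsMaximal :=
  pointIdeal_isMaximal (gtVec_mem hβ hp m) (gtVec_ne_zero hβ hp m)

lemma pointIdeal_shift_injective (hβ : IsGeneric β) (hp : 0 < p) {m m' : Fin p → ℤ}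
    (h : pointIdeal (shift β m) γ = pointIdeal (shift β m') γ) : m = m' := by
  by_contra hne
  obtain ⟨g, hg, hg'⟩ := exists_separating hβ hp (γ := γ) {m'} m
  have h1 := (mem_pointIdeal_iff (gtVec_mem hβ hp m') (gtVec_ne_zero hβ hp m')).2
    (hg' m' (Finset.mem_singleton_self _) (Ne.symm hne))
  rw [← h, mem_pointIdeal_iff (gtVec_mem hβ hp m) (gtVec_ne_zero hβ hp m), hg] at h1
  exact gtVec_ne_zero hβ hp m h1

/-- The points of the weights `β` and `β + m` are linked. -/
lemma linked_pointIdeal (hβ : IsGeneric β) (hp : 0 < p) (m : Fin p → ℤ) :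
    ∃ a : Y k p, Linked (Gam k p) a (pointIdeal β γ) (pointIdeal (shift β m) γ) := by
  obtain ⟨a, ha⟩ := exists_smul_gtVec_zero hβ hp (γ := γ) m
  have hβ0 : gtVec hβ hp γ 0 ∈ weightSpace β γ (GT hβ hp γ) := by
    simpa only [shift_zero] using gtVec_mem hβ hp (γ := γ) 0
  refine ⟨a, linked_of_smul (Gam k p) ha (fun z hz => smul_eq_zero_of_mem_pointIdeal hβ0 hz)
    (fun z => ?_) fun z => mem_pointIdeal_iff (gtVec_mem hβ hp m) (gtVec_ne_zero hβ hp m)⟩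
  obtain ⟨c, w, hw, rfl⟩ := exists_eq_add_mem_pointIdeal β γ z
  refine ⟨algebraMap k _ c, ?_⟩
  rw [add_smul_of_mem_pointIdeal hβ0 c hw, smul_smul_comm', ha]
  exact (algebraMap_smul (Y k p) c _).symm

end GTModule

/-! ### Quotients of the Gelfand–Tsetlin module -/

section Quotients

variable {k : Type*} [Field k] [CharZero k] {p : ℕ} {β : Fin p → k} {hβ : IsGeneric β} {hp : 0 < p}
  {γ : Fin (2 * p) → k}
variable {Q : Type*} [AddCommGroup Q] [Module (Y k p) Q] [Module k Q] [IsScalarTower k (Y k p) Q]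
  (π : GT hβ hp γ →ₗ[Y k p] Q)

lemma map_gtVec_mem (m : Fin p → ℤ) :
    π (gtVec hβ hp γ m) ∈ weightSpace (shift β m) γ Q := by
  have h := mem_weightSpace_iff.1 (gtVec_mem hβ hp (γ := γ) m)
  refine mem_weightSpace_iff.2 ⟨fun u => ?_, fun u => ?_⟩
  · rw [← map_smul, h.1, π.map_smul_of_tower]
  · rw [← map_smul, h.2, π.map_smul_of_tower]

variable {π}

lemma eq_sum_of_surjective (hπ : Function.Surjective π) (x : Q) :
    ∃ (S : Finset (Fin p → ℤ)) (c : (Fin p → ℤ) → k),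
      x = ∑ m ∈ S, c m • π (gtVec hβ hp γ m) := by
  obtain ⟨w, rfl⟩ := hπ x
  obtain ⟨S, c, rfl⟩ := gt_eq_sum hβ hp w
  exact ⟨S, c, by simp only [map_sum, π.map_smul_of_tower]⟩

/-- A separating element picks out one component of a vector. -/
lemma smul_sum_of_separating {S : Finset (Fin p → ℤ)} {m₀ : Fin p → ℤ} {g : Y k p}
    (hg : ∀ m ∈ S, m ≠ m₀ → g • gtVec hβ hp γ m = 0) (h₀ : m₀ ∈ S) (c : (Fin p → ℤ) → k) :
    g • ∑ m ∈ S, c m • π (gtVec hβ hp γ m) = c m₀ • g • π (gtVec hβ hp γ m₀) := by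
  rw [Finset.smul_sum, Finset.sum_eq_single m₀, smul_smul_comm']
  · intro m hm hne
    rw [smul_smul_comm', ← map_smul, hg m hm hne, map_zero, smul_zero]
  · exact fun h => (h h₀).elim

lemma hasCentralCharacter_of_surjective (hπ : Function.Surjective π) :
    HasCentralCharacter γ Q := by
  intro x r
  obtain ⟨w, rfl⟩ := hπ x
  rw [← map_smul, gt_hasCentralCharacter hβ hp w r, π.map_smul_of_tower]

/-- If M differs from the point ideal of m, some a ∈ M acts on the m-component by a scalar d ≠ 0. A
separating element isolates that component, and a^r kills x, so d^r annihilates it. Hence only the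
component with point ideal M survives. -/
lemma eq_smul_of_mem_genWeightSpace (hπ : Function.Surjective π) (M : Sp (Gam k p)) {x : Q}
    (hx : x ∈ genWeightSpace (Gam k p) Q M.1) :
    x = 0 ∨ ∃ (m : Fin p → ℤ) (c : k), M.1 = pointIdeal (shift β m) γ ∧
      x = c • π (gtVec hβ hp γ m) := by
  obtain ⟨r, hr⟩ := hx
  obtain ⟨S, c, hS⟩ := eq_sum_of_surjective hπ x
  have key : ∀ m ∈ S, M.1 ≠ pointIdeal (shift β m) γ → c m • π (gtVec hβ hp γ m) = 0 := by
    intro m hm hne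
    have hnot : ¬ M.1 ≤ pointIdeal (shift β m) γ := fun hle =>
      hne (M.2.eq_of_le (gt_pointIdeal_isMaximal hβ hp m).ne_top hle)
    obtain ⟨a, haM, ha⟩ := SetLike.not_le_iff_exists.1 hnot
    obtain ⟨d, w, hw, rfl⟩ := exists_eq_add_mem_pointIdeal (shift β m) γ a
    have hd : d ≠ 0 := fun h => ha (by rwa [h, map_zero, zero_add])
    set a : Gam k p := algebraMap k _ d + w with ha_def
    have hpow : ∀ n : ℕ, (((a ^ n : Gam k p)) : Y k p) • π (gtVec hβ hp γ m) =
        d ^ n • π (gtVec hβ hp γ m) := by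
      intro n
      induction n with
      | zero => rw [pow_zero, pow_zero, one_smul]; exact one_smul _ _
      | succ n ih =>
        have e : ((a ^ (n + 1) : Gam k p) : Y k p) = (a ^ n : Gam k p) * (a : Y k p) := by
          rw [pow_succ]; rfl
        rw [e, mul_smul, add_smul_of_mem_pointIdeal (map_gtVec_mem π m) d hw, smul_smul_comm', ih,
          smul_smul, pow_succ']
    have hscal : ∀ m', ∃ d' : k, ((a ^ r : Gam k p) : Y k p) • gtVec hβ hp γ m' =
        d' • gtVec hβ hp γ m' := by
      intro m'
      obtain ⟨d', w', hw', h'⟩ := exists_eq_add_mem_pointIdeal (shift β m') γ (a ^ r)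
      exact ⟨d', by rw [h', add_smul_of_mem_pointIdeal (gtVec_mem hβ hp m') d' hw']⟩
    obtain ⟨g, hg, hg'⟩ := exists_separating hβ hp (γ := γ) S m
    have h1 := hr (g * a ^ r) (Ideal.mul_mem_left _ g (Submodule.pow_mem_pow M.1 haM r))
    have e : ((g * a ^ r : Gam k p) : Y k p) = (g : Y k p) * ((a ^ r : Gam k p) : Y k p) := rfl
    rw [hS, smul_sum_of_separating (m₀ := m) (fun m' hm' hne' => ?_) hm, e, mul_smul, hpow,
      smul_smul_comm', ← map_smul, hg, smul_comm] at h1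
    · exact (smul_eq_zero.1 h1).resolve_left (pow_ne_zero r hd)
    · obtain ⟨d', hd'⟩ := hscal m'
      rw [e, mul_smul, hd', smul_smul_comm', hg' m' hm' hne', smul_zero]
  by_cases h : ∃ m ∈ S, c m • π (gtVec hβ hp γ m) ≠ 0
  · obtain ⟨m, hm, hne⟩ := h
    have hM : M.1 = pointIdeal (shift β m) γ := by
      by_contra hM
      exact hne (key m hm hM)
    refine Or.inr ⟨m, c m, hM, ?_⟩
    rw [hS, Finset.sum_eq_single_of_mem m hm]
    intro m' hm' hne'
    refine key m' hm' fun h => hne' (pointIdeal_shift_injective hβ hp (h.symm.trans hM))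
  · push Not at h
    exact Or.inl (hS.trans (Finset.sum_eq_zero h))

lemma map_gtVec_mem_genWeightSpace (m : Fin p → ℤ) :
    π (gtVec hβ hp γ m) ∈ genWeightSpace (Gam k p) Q (pointIdeal (shift β m) γ) := by
  refine ⟨1, fun z hz => ?_⟩
  rw [Submodule.pow_one] at hz
  exact smul_eq_zero_of_mem_pointIdeal (map_gtVec_mem π m) hz

lemma iSupIndep_genWeightSpace (hπ : Function.Surjective π) :
    iSupIndep fun M : Sp (Gam k p) => genWeightSpace (Gam k p) Q M.1 := by
  classical
  rw [iSupIndep_def]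
  intro M
  rw [Submodule.disjoint_def]
  intro x hx hx'
  obtain rfl | ⟨m, c, hM, rfl⟩ := eq_smul_of_mem_genWeightSpace hπ M hx
  · rfl
  -- K collects the vectors killed by every element that kills the basis vectors from some finite
  -- set, m excepted. It contains all other weight spaces, whereas a separating element for m fixes
  -- the image of the m-th basis vector.
  let K : Submodule k Q :=
    { carrier := {y | ∃ S : Finset (Fin p → ℤ), ∀ g : Y k p,
        (∀ m' ∈ S, m' ≠ m → g • gtVec hβ hp γ m' = 0) → g • y = 0}
      zero_mem' := ⟨∅, fun g _ => smul_zero g⟩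
      add_mem' := by
        rintro y z ⟨S, hS⟩ ⟨S', hS'⟩
        refine ⟨S ∪ S', fun g hg => ?_⟩
        rw [smul_add, hS g fun m' h => hg m' (Finset.mem_union_left _ h),
          hS' g fun m' h => hg m' (Finset.mem_union_right _ h), add_zero]
      smul_mem' := by
        rintro d y ⟨S, hS⟩
        exact ⟨S, fun g hg => by rw [smul_smul_comm', hS g hg, smul_zero]⟩ }
  have hK : ⨆ M', ⨆ (_ : M' ≠ M), genWeightSpace (Gam k p) Q M'.1 ≤ K := by
    refine iSup₂_le fun M' hM' y hy => ?_
    obtain rfl | ⟨m', d, hm', rfl⟩ := eq_smul_of_mem_genWeightSpace hπ M' hy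
    · exact K.zero_mem
    · refine K.smul_mem d ⟨{m'}, fun g hg => ?_⟩
      rw [← map_smul, hg m' (Finset.mem_singleton_self _), map_zero]
      rintro rfl
      exact hM' (Subtype.ext (hm'.trans hM.symm))
  obtain ⟨S, hS⟩ := hK hx'
  obtain ⟨g, hg, hg'⟩ := exists_separating hβ hp (γ := γ) S m
  have := hS g hg'
  rwa [smul_smul_comm', ← map_smul, hg] at this

lemma isWeightModule_of_surjective (hπ : Function.Surjective π) :
    IsWeightModule (Gam k p) Q := by
  have : Module.Finite (Y k p) (GT hβ hp γ) :=
    ⟨⟨{gtVec hβ hp γ 0}, by rw [Finset.coe_singleton]; exact span_gtVec_zero hβ hp⟩⟩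
  refine ⟨⟨Module.Finite.of_surjective π hπ, iSupIndep_genWeightSpace hπ, ?_⟩, fun M x hx z hz => ?_⟩
  · rw [eq_top_iff]
    rintro x -
    obtain ⟨S, c, rfl⟩ := eq_sum_of_surjective hπ x
    refine Submodule.sum_mem _ fun m _ => Submodule.smul_mem _ _ ?_
    exact Submodule.mem_iSup_of_mem
      (⟨pointIdeal (shift β m) γ, gt_pointIdeal_isMaximal hβ hp m⟩ : Sp (Gam k p))
      (map_gtVec_mem_genWeightSpace m)
  · obtain rfl | ⟨m, c, hM, rfl⟩ := eq_smul_of_mem_genWeightSpace hπ M hx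
    · exact smul_zero _
    · rw [hM] at hz
      rw [smul_smul_comm', smul_eq_zero_of_mem_pointIdeal (map_gtVec_mem π m) hz, smul_zero]

lemma supp_subset_blockClass (hπ : Function.Surjective π) :
    Supp (Gam k p) Q ⊆ blockClass β γ := by
  intro M hM
  obtain ⟨x, hx, hx0⟩ := Submodule.exists_mem_ne_zero_of_ne_bot hM
  obtain ⟨m, c, hm, -⟩ := (eq_smul_of_mem_genWeightSpace hπ M hx).resolve_left hx0
  have h0 := gt_pointIdeal_isMaximal hβ hp (γ := γ) 0
  rw [shift_zero] at h0
  obtain ⟨a, ha⟩ := linked_pointIdeal hβ hp (γ := γ) m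
  refine ⟨⟨pointIdeal β γ, h0⟩, rfl, Relation.EqvGen.rel _ _ ⟨a, ?_⟩⟩
  rw [hm]
  exact ha

lemma isGenericWeightModule_of_surjective (hπ : Function.Surjective π) :
    IsGenericWeightModule k p Q :=
  ⟨β, γ, hβ, isWeightModule_of_surjective hπ, hasCentralCharacter_of_surjective hπ,
    supp_subset_blockClass hπ⟩

/-- Comparing g x with g T₂₂(u) x for a separating g shows that each nonzero component of x has
weight polynomial ψ(u), and different m have different polynomials. Polynomials are compared, not
tuples, since ψ matters only up to permutation. -/
lemma finrank_weightSpace_eq_one (hπ : Function.Surjective π) {ψ : Fin p → k}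
    (hψ : weightSpace ψ γ Q ≠ ⊥) : Module.finrank k (weightSpace ψ γ Q) = 1 := by
  have key : ∀ x ∈ weightSpace ψ γ Q, x = 0 ∨ ∃ (m : Fin p → ℤ) (c : k),
      (∀ u, (tuplePoly (shift β m)).eval u = (tuplePoly ψ).eval u) ∧
      x = c • π (gtVec hβ hp γ m) := by
    intro x hx
    obtain ⟨S, c, hS⟩ := eq_sum_of_surjective hπ x
    have hev : ∀ m ∈ S, c m • π (gtVec hβ hp γ m) ≠ 0 →
        ∀ u, (tuplePoly (shift β m)).eval u = (tuplePoly ψ).eval u := by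
      intro m hm hne u
      obtain ⟨g, hg, hg'⟩ := exists_separating hβ hp (γ := γ) S m
      have h1 := smul_sum_of_separating (π := π) hg' hm c
      have hw := fun m => (mem_weightSpace_iff.1 (gtVec_mem hβ hp (γ := γ) m)).1 u
      have h2 := smul_sum_of_separating (π := π) (g := (g : Y k p) * Tval 1 1 u) (m₀ := m) (S := S)
        (fun m' hm' hne' => by rw [mul_smul, hw, smul_smul_comm', hg' m' hm' hne', smul_zero]) hm c
      rw [← hS, ← map_smul, hg] at h1
      rw [← hS, mul_smul, mul_smul, (mem_weightSpace_iff.1 hx).1 u, smul_smul_comm', h1,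
        (mem_weightSpace_iff.1 (map_gtVec_mem π m)).1 u, smul_smul_comm', ← map_smul π (g : Y k p),
        hg, smul_comm (c m), ← sub_eq_zero, ← sub_smul] at h2
      exact (sub_eq_zero.1 ((smul_eq_zero.1 h2).resolve_right hne)).symm
    by_cases h : ∃ m ∈ S, c m • π (gtVec hβ hp γ m) ≠ 0
    · obtain ⟨m, hm, hne⟩ := h
      refine Or.inr ⟨m, c m, hev m hm hne, ?_⟩
      rw [hS, Finset.sum_eq_single_of_mem m hm]
      intro m' hm' hne'
      by_contra hne2
      obtain ⟨u, hu, hu'⟩ := exists_eval_ne hβ hne'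
      exact hu' (by rw [hev m hm hne u, ← hev m' hm' hne2 u, hu])
    · push Not at h
      exact Or.inl (hS.trans (Finset.sum_eq_zero h))
  obtain ⟨x, hx, hx0⟩ := Submodule.exists_mem_ne_zero_of_ne_bot hψ
  obtain ⟨m, c, hm, rfl⟩ := (key x hx).resolve_left hx0
  have hspan : weightSpace ψ γ Q = Submodule.span k {c • π (gtVec hβ hp γ m)} := by
    apply le_antisymm
    · intro y hy
      obtain rfl | ⟨m', c', hm', rfl⟩ := key y hy
      · exact Submodule.zero_mem _
      · have : m' = m := by
          by_contra hne
          obtain ⟨u, hu, hu'⟩ := exists_eval_ne hβ hne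
          exact hu' (by rw [hm u, ← hm' u, hu])
        subst this
        have hc : c ≠ 0 := fun h => hx0 (by rw [h, zero_smul])
        refine Submodule.mem_span_singleton.2 ⟨c' * c⁻¹, ?_⟩
        rw [smul_smul, mul_assoc, inv_mul_cancel₀ hc, mul_one]
    · rw [Submodule.span_singleton_le_iff_mem]
      exact hx
  rw [hspan]
  exact finrank_span_singleton hx0

end Quotients

/-! ### The largest proper submodule of the Gelfand–Tsetlin module -/

section Radical

variable {k : Type*} [Field k] {p : ℕ} {β : Fin p → k} {hβ : IsGeneric β} {hp : 0 < p}
  {γ : Fin (2 * p) → k}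

/-- The coordinate of the basis vector of weight `β`. -/
def gtCoord : GT hβ hp γ →ₗ[k] k := Finsupp.lapply (0 : Fin p → ℤ)

lemma gtCoord_gtVec_zero : gtCoord (gtVec hβ hp γ 0) = 1 :=
  Finsupp.single_eq_same

lemma gtCoord_gtVec_of_ne {m : Fin p → ℤ} (h : m ≠ 0) : gtCoord (gtVec hβ hp γ m) = 0 :=
  Finsupp.single_eq_of_ne (Ne.symm h)

variable [CharZero k]

lemma exists_smul_eq_gtCoord (w : GT hβ hp γ) :
    ∃ g : Y k p, g • w = gtCoord w • gtVec hβ hp γ 0 := by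
  obtain ⟨S, c, rfl⟩ := gt_eq_sum hβ hp w
  obtain ⟨g, hg, hg'⟩ := exists_separating hβ hp (γ := γ) S 0
  refine ⟨g, ?_⟩
  rw [Finset.smul_sum, map_sum, Finset.sum_smul]
  refine Finset.sum_congr rfl fun m hm => ?_
  rw [smul_smul_comm', map_smul]
  rcases eq_or_ne m 0 with rfl | h
  · rw [hg, gtCoord_gtVec_zero, smul_eq_mul, mul_one]
  · rw [hg' m hm h, gtCoord_gtVec_of_ne h, smul_zero, smul_zero, zero_smul]

variable (hβ hp γ) in
/-- The largest proper submodule of the Gelfand–Tsetlin module. -/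
def gtRadical : Submodule (Y k p) (GT hβ hp γ) where
  carrier := {w | ∀ y : Y k p, gtCoord (y • w) = 0}
  zero_mem' y := by rw [smul_zero, map_zero]
  add_mem' hw hw' y := by rw [smul_add, map_add, hw, hw', add_zero]
  smul_mem' z w hw y := by rw [smul_smul]; exact hw _

/-- If y w has a nonzero coordinate at weight β, a separating element turns it into a multiple of
the generator, so a submodule containing w is everything. -/
lemma le_gtRadical {N : Submodule (Y k p) (GT hβ hp γ)} (hN : N ≠ ⊤) : N ≤ gtRadical hβ hp γ := by
  intro w hw y
  by_contra h
  obtain ⟨g, hg⟩ := exists_smul_eq_gtCoord (y • w)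
  refine hN (eq_top_iff.2 ?_)
  rw [← span_gtVec_zero hβ hp, Submodule.span_singleton_le_iff_mem]
  have h1 : g • y • w ∈ N := N.smul_mem _ (N.smul_mem _ hw)
  rw [hg] at h1
  have h2 := N.smul_mem (algebraMap k (Y k p) (gtCoord (y • w))⁻¹) h1
  rwa [algebraMap_smul, smul_smul, inv_mul_cancel₀ h, one_smul] at h2

lemma gtRadical_ne_top : gtRadical hβ hp γ ≠ ⊤ := fun h => by
  have h1 : gtVec hβ hp γ 0 ∈ gtRadical hβ hp γ := h ▸ Submodule.mem_top
  have := h1 1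
  rw [one_smul, gtCoord_gtVec_zero] at this
  exact one_ne_zero this

end Radical

/-! ### Modules with a largest proper submodule, and cyclic modules -/

/-- A nonzero quotient of a module with a largest proper submodule has a largest proper submodule. -/
lemma isCoatom_sSup_of_surjective {R M N : Type*} [Ring R] [AddCommGroup M] [Module R M]
    [AddCommGroup N] [Module R N] [Nontrivial N] {f : M →ₗ[R] N} (hf : Function.Surjective f)
    {J : Submodule R M} (hJ : J ≠ ⊤) (h : ∀ K : Submodule R M, K ≠ ⊤ → K ≤ J) :
    IsCoatom (sSup {K : Submodule R N | K ≠ ⊤}) := by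
  have hcomap : ∀ K : Submodule R N, K ≠ ⊤ → K.comap f ≤ J := fun K hK => h _ fun htop => hK <| by
    rw [← Submodule.map_comap_eq_of_surjective hf K, htop, Submodule.map_top,
      LinearMap.range_eq_top.2 hf]
  have hker : LinearMap.ker f ≤ J := hcomap ⊥ bot_ne_top
  have hle : sSup {K : Submodule R N | K ≠ ⊤} ≤ J.map f := sSup_le fun K hK => by
    rw [← Submodule.map_comap_eq_of_surjective hf K]
    exact Submodule.map_mono (hcomap K hK)
  refine ⟨fun htop => hJ ?_, fun K hK => ?_⟩
  · have : (J.map f).comap f = J := by rw [Submodule.comap_map_eq, sup_eq_left.2 hker]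
    have htop' : J.map f = ⊤ := eq_top_iff.2 (htop ▸ hle)
    rw [← this, htop', Submodule.comap_top]
  · by_contra hne
    exact hK.not_ge (le_sSup hne)

/-- If the proper submodules of `M` generate a proper submodule, the simple quotients of `M` are
isomorphic to the quotient by it. -/
lemma nonempty_equiv_of_surjective {R M V : Type*} [Ring R] [AddCommGroup M] [Module R M]
    [AddCommGroup V] [Module R V] [IsSimpleModule R V] {f : M →ₗ[R] V} (hf : Function.Surjective f)
    (hM : IsCoatom (sSup {K : Submodule R M | K ≠ ⊤})) :
    Nonempty (V ≃ₗ[R] (M ⧸ sSup {K : Submodule R M | K ≠ ⊤})) := by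
  have e := f.quotKerEquivOfSurjective hf
  have : IsSimpleModule R (M ⧸ LinearMap.ker f) := IsSimpleModule.congr e
  have hker : IsCoatom (LinearMap.ker f) := isSimpleModule_iff_isCoatom.1 this
  have hle : LinearMap.ker f ≤ sSup {K : Submodule R M | K ≠ ⊤} := le_sSup hker.1
  have heq := (hker.le_iff.1 hle).resolve_left hM.1
  exact ⟨e.symm.trans (Submodule.quotEquivOfEq _ _ heq.symm)⟩

lemma isSimpleModule_quotient_of_isCoatom {R M : Type*} [Ring R] [AddCommGroup M] [Module R M]
    {J : Submodule R M} (hJ : IsCoatom J) : IsSimpleModule R (M ⧸ J) :=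
  isSimpleModule_iff_isCoatom.2 hJ

/-- The homomorphism from the quotient by a left ideal given by a vector killed by generators. -/
lemma exists_hom_of_smul_eq_zero {R V : Type*} [Ring R] [AddCommGroup V] [Module R V] {s : Set R}
    {v : V} (h : ∀ x ∈ s, x • v = 0) : ∃ f : (R ⧸ (Ideal.span s : Ideal R)) →ₗ[R] V,
      f (Submodule.Quotient.mk 1) = v := by
  refine ⟨Submodule.liftQ _ (LinearMap.toSpanSingleton R V v) ?_, ?_⟩
  · rw [Ideal.span, Submodule.span_le]
    exact h
  · rw [Submodule.liftQ_apply, LinearMap.toSpanSingleton_apply, one_smul]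

lemma surjective_of_span_singleton {R M V : Type*} [Ring R] [AddCommGroup M] [Module R M]
    [AddCommGroup V] [Module R V] {f : M →ₗ[R] V} {x : M} {v : V} (hx : f x = v)
    (hv : Submodule.span R {v} = ⊤) : Function.Surjective f := by
  rw [← LinearMap.range_eq_top, eq_top_iff, ← hv, Submodule.span_singleton_le_iff_mem]
  exact ⟨x, hx⟩

lemma smul_mk_one_eq_of_sub_mem {R : Type*} [Ring R] {I : Ideal R} {x y : R} (h : x - y ∈ I) :
    x • (Submodule.Quotient.mk 1 : R ⧸ I) = y • (Submodule.Quotient.mk 1 : R ⧸ I) := by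
  rw [← Submodule.Quotient.mk_smul, ← Submodule.Quotient.mk_smul, Submodule.Quotient.eq,
    smul_eq_mul, smul_eq_mul, mul_one, mul_one]
  exact h

lemma span_mk_one {R : Type*} [Ring R] (I : Ideal R) :
    Submodule.span R {(Submodule.Quotient.mk 1 : R ⧸ I)} = ⊤ := by
  rw [eq_top_iff]
  rintro x -
  obtain ⟨y, rfl⟩ := Submodule.Quotient.mk_surjective _ x
  refine Submodule.mem_span_singleton.2 ⟨y, ?_⟩
  rw [← Submodule.Quotient.mk_smul, smul_eq_mul, mul_one]

/-! ### The universal module M(ℓ) -/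

section Main

variable {k : Type*} [Field k] {p : ℕ} {β : Fin p → k} {γ : Fin (2 * p) → k}

lemma smul_eq_zero_of_mem_weightRelators {V : Type*} [AddCommGroup V] [Module (Y k p) V]
    [Module k V] [IsScalarTower k (Y k p) V] {v : V} (hv : v ∈ weightSpace β γ V) {x : Y k p}
    (hx : x ∈ weightRelators β γ) : x • v = 0 := by
  obtain ⟨r, rfl | rfl⟩ := hx
  · rw [sub_smul, algebraMap_smul, (hv r).1, sub_self]
  · rw [sub_smul, algebraMap_smul, (hv r).2, sub_self]

lemma mk_one_mem_weightSpace :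
    (Submodule.Quotient.mk 1 : univModule β γ) ∈ weightSpace β γ (univModule β γ) := by
  have key : ∀ (y : Y k p) (c : k), y - algebraMap k (Y k p) c ∈ weightRelators β γ →
      y • (Submodule.Quotient.mk 1 : univModule β γ) =
        c • (Submodule.Quotient.mk 1 : univModule β γ) := by
    intro y c h
    rw [← algebraMap_smul (Y k p) c (Submodule.Quotient.mk 1 : univModule β γ)]
    exact smul_mk_one_eq_of_sub_mem (Ideal.subset_span h)
  exact fun r => ⟨key _ _ ⟨r, Or.inl rfl⟩, key _ _ ⟨r, Or.inr rfl⟩⟩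

/-- M(ℓ) is a quotient of `GT`, so it inherits a largest proper submodule once it is nonzero; the
map back to `GT` sends the class of 1 to a nonzero vector. -/
lemma isCoatom_sSup_univModule (hβ : IsGeneric β) (hp : 0 < p) [CharZero k] :
    IsCoatom (sSup {N : Submodule (Y k p) (univModule β γ) | N ≠ ⊤}) := by
  obtain ⟨π, hπ⟩ := exists_gt_hom hβ hp (mk_one_mem_weightSpace (β := β) (γ := γ))
  have hmem : gtVec hβ hp γ 0 ∈ weightSpace β γ (GT hβ hp γ) := by
    simpa only [shift_zero] using gtVec_mem hβ hp 0
  obtain ⟨f, hf⟩ := exists_hom_of_smul_eq_zero fun x hx =>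
    smul_eq_zero_of_mem_weightRelators hmem hx
  have : Nontrivial (univModule β γ) := nontrivial_of_ne (Submodule.Quotient.mk 1) 0 fun h =>
    gtVec_ne_zero hβ hp 0 (by rw [← hf, h, map_zero])
  exact isCoatom_sSup_of_surjective (surjective_of_span_singleton hπ (span_mk_one _))
    (gtRadical_ne_top (hβ := hβ) (hp := hp)) fun K hK => le_gtRadical hK

/-- The generator of `GT` cannot map to zero in a nonzero quotient. -/
lemma weightSpace_ne_bot_of_surjective [CharZero k] {hβ : IsGeneric β} {hp : 0 < p} {Q : Type*}
    [AddCommGroup Q] [Module (Y k p) Q] [Module k Q] [IsScalarTower k (Y k p) Q] [Nontrivial Q]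
    {π : GT hβ hp γ →ₗ[Y k p] Q} (hπ : Function.Surjective π) : weightSpace β γ Q ≠ ⊥ := by
  intro h
  have h1 : π (gtVec hβ hp γ 0) ∈ weightSpace β γ Q := by
    simpa only [shift_zero] using map_gtVec_mem (π := π) 0
  rw [h, Submodule.mem_bot] at h1
  have h2 : π = 0 := LinearMap.ext_on (span_gtVec_zero hβ hp) fun x hx => by
    rw [Set.mem_singleton_iff.1 hx, h1, LinearMap.zero_apply]
  obtain ⟨x, hx⟩ := exists_ne (0 : Q)
  obtain ⟨y, rfl⟩ := hπ x
  exact hx (by rw [h2, LinearMap.zero_apply])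

end Main

end LevelYangian

end

theorem corollary4 {k : Type*} [Field k] [IsAlgClosed k] [CharZero k] (p : ℕ) (hp : 0 < p)
    (β : Fin p → k) (γ : Fin (2 * p) → k) (hβ : LevelYangian.IsGeneric β) :
    (IsSimpleModule (LevelYangian.Y k p) (LevelYangian.L β γ) ∧
      LevelYangian.IsGenericWeightModule k p (LevelYangian.L β γ) ∧
      LevelYangian.HasCentralCharacter γ (LevelYangian.L β γ) ∧
      LevelYangian.weightSpace β γ (LevelYangian.L β γ) ≠ ⊥ ∧
      ∀ ψ : Fin p → k, LevelYangian.weightSpace ψ γ (LevelYangian.L β γ) ≠ ⊥ →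
        Module.finrank k (LevelYangian.weightSpace ψ γ (LevelYangian.L β γ)) = 1) ∧
    ∀ (V : Type*) [AddCommGroup V] [Module (LevelYangian.Y k p) V] [Module k V]
      [IsScalarTower k (LevelYangian.Y k p) V],
      IsSimpleModule (LevelYangian.Y k p) V →
      LevelYangian.IsWeightModule (LevelYangian.Gam k p) V →
      LevelYangian.HasCentralCharacter γ V →
      (∃ η ∈ LevelYangian.weightSpace β γ V, η ≠ 0 ∧
        Submodule.span (LevelYangian.Y k p) {η} = ⊤) →
      Nonempty (V ≃ₗ[LevelYangian.Y k p] LevelYangian.L β γ) := by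
  obtain ⟨π₀, hπ₀⟩ := LevelYangian.exists_gt_hom hβ hp
    (LevelYangian.mk_one_mem_weightSpace (β := β) (γ := γ))
  have hsurj₀ : Function.Surjective π₀ :=
    LevelYangian.surjective_of_span_singleton hπ₀ (LevelYangian.span_mk_one _)
  have hco : IsCoatom
      (sSup {N : Submodule (LevelYangian.Y k p) (LevelYangian.univModule β γ) | N ≠ ⊤}) :=
    LevelYangian.isCoatom_sSup_univModule hβ hp
  have hsimple : IsSimpleModule (LevelYangian.Y k p) (LevelYangian.L β γ) :=
    LevelYangian.isSimpleModule_quotient_of_isCoatom hco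
  have : Nontrivial (LevelYangian.L β γ) := IsSimpleModule.nontrivial (LevelYangian.Y k p) _
  obtain ⟨π, hπ⟩ : ∃ π : LevelYangian.GT hβ hp γ →ₗ[LevelYangian.Y k p] LevelYangian.L β γ,
      Function.Surjective π :=
    ⟨(Submodule.mkQ _).comp π₀, (Submodule.mkQ_surjective _).comp hsurj₀⟩
  refine ⟨⟨hsimple, LevelYangian.isGenericWeightModule_of_surjective hπ,
    LevelYangian.hasCentralCharacter_of_surjective hπ,
    LevelYangian.weightSpace_ne_bot_of_surjective hπ, fun ψ hψ =>
    LevelYangian.finrank_weightSpace_eq_one hπ hψ⟩, ?_⟩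
  -- The vector η is killed by the generators of I_ℓ and generates V, so V is a simple quotient of
  -- M(ℓ), and the kernel must be the largest proper submodule.
  rintro V _ _ _ _ hV - - ⟨η, hη, -, hspan⟩
  obtain ⟨f, hf⟩ := LevelYangian.exists_hom_of_smul_eq_zero fun x hx =>
    LevelYangian.smul_eq_zero_of_mem_weightRelators hη hx
  exact LevelYangian.nonempty_equiv_of_surjective
    (LevelYangian.surjective_of_span_singleton hf hspan) hco
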